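/- Let $k$ be a field. Let $\mathcal A'$ be a locally noetherian Grothendieck abelian category (the noetherian objects generate), and let $\mathcal A$ be an abelian $k$-linear category with finite-dimensional Hom-spaces, identified through a fully faithful exact functor $\mathcal A\to\mathcal A'$ with the full subcategory of noetherian objects of $\mathcal A'$. (For example $\mathcal A=\operatorname{mod}\Lambda\subseteq\mathcal A'=\operatorname{Mod}\Lambda$ for a finite-dimensional $k$-algebra $\Lambda$; or a noetherian abelian $k$-category $\mathcal A$ of finite homological dimension with Hom-finite $D^b(\mathcal A)$ that is the category of noetherian objects of a locally noetherian Grothendieck $k$-category $\mathcal A'$ of finite homological dimension.) Let $T\in\mathcal A$, let $\widehat{\mathcal B}=\operatorname{mod}(\operatorname{End}(T)^{op})$ be the category of finitely generated $\operatorname{End}(T)^{op}$-modules, and suppose that $T$ is a tilting object of homological dimension $2$ in the following sense: $R\mathrm{Hom}(T,-)$ (the right derived functor of $\mathrm{Hom}(T,-)$, computed with injective resolutions in $\mathcal A'$) induces an equivalence of triangulated categories $F=R\mathrm{Hom}(T,-):D^b(\mathcal A)\to D^b(\widehat{\mathcal B})$, and $H^iF(X)=\mathrm{Ext}^i(T,X)=0$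 for all $X\in\mathcal A$ and $i\ge 3$. Regard $\mathcal A$ and $\widehat{\mathcal B}$ as full subcategories, closed under isomorphism, of $D^b(\mathcal A)$ and $D^b(\widehat{\mathcal B})$ (complexes concentrated in degree $0$), and put $\mathcal B=F^{-1}(\widehat{\mathcal B})\subseteq D^b(\mathcal A)$. Write $\Sigma$ for the suspension, and for full subcategories $\mathcal X,\mathcal Z$ of $D^b(\mathcal A)$ let $\mathcal X*\mathcal Z$ be the full subcategory of all $y$ admitting a triangle $x\to y\to z\to\Sigma x$ with $x\in\mathcal X$, $z\in\mathcal Z$. Then $$\mathcal A\subseteq\mathcal B*\Sigma^{-1}\mathcal B*\Sigma^{-2}\mathcal B\qquad\text{and}\qquad \mathcal B\subseteq\Sigma^{2}\mathcal A*\Sigma\mathcal A*\mathcal A .$$ Consequently the filtration theorem of Jensen, Madsen and Su holds. Namely, put $\mathcal F^i=\{x\in\mathcal A\mid H^jF(x)=0\text{ for }j\ne i\}$; then $\mathcal F^i=\mathcal A\cap\Sigma^{-i}\mathcal B$ for all $i$. Define $\mathcal E_0=\langle\mathrm{Gen}(\mathcal F^0)\rangle$, $\mathcal E_1=\mathcal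 F^1$ and $\mathcal E_2=\langle\mathrm{Sub}(\mathcal F^2)\rangle$, where $\mathrm{Gen}(S)$ and $\mathrm{Sub}(S)$ consist of the quotients and the subobjects in $\mathcal A$ of objects of $S$, and $\langle S\rangle$ of the objects with a finite filtration with all subquotients in $S\cup\{0\}$. Then $\mathcal E_0,\mathcal E_1,\mathcal E_2$ are closed under extensions, $\mathrm{Hom}(\mathcal E_i,\mathcal E_j)=0$ for $i<j$, and every $x\in\mathcal A$ has a unique filtration by subobjects $0=x_0\subseteq x_1\subseteq x_2\subseteq x_3=x$ with $x_{i+1}/x_i\in\mathcal E_i$ for $i=0,1,2$. -/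

import Mathlib

open CategoryTheory CategoryTheory.Limits CategoryTheory.Pretriangulated

universe w w' w₁ w₂ w₃ w₄ v u u'

noncomputable section

namespace JMS

/-! ### Classes of objects in an abelian category -/

section Abelian

variable {C : Type u} [Category.{v} C] [Abelian C]

/-- The subquotient `q / p` attached to subobjects `p ≤ q` of `x`. -/
def subquotient {x : C} {p q : Subobject x} (h : p ≤ q) : C :=
  cokernel (Subobject.ofLE p q h)

/-- `Gen S`: the objects `x` which admit an epimorphism `s ↠ x` with `s ∈ S`. -/
def gen (S : ObjectProperty C) : ObjectProperty C :=
  fun x => ∃ (s : C) (_ : S s) (f : s ⟶ x), Epi f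

/-- `Sub S`: the objects `x` which admit a monomorphism `x ↣ s` with `s ∈ S`. -/
def sub (S : ObjectProperty C) : ObjectProperty C :=
  fun x => ∃ (s : C) (_ : S s) (f : x ⟶ s), Mono f

/-- The extension closure `⟨S⟩`: the objects `a` having a finite filtration
`0 = a₀ ⊆ a₁ ⊆ ⋯ ⊆ aₙ = a` all of whose subquotients `aᵢ₊₁ / aᵢ` lie in `S ∪ {0}`. -/
def extClosure (S : ObjectProperty C) : ObjectProperty C :=
  fun a => ∃ (n : ℕ) (p : ℕ → Subobject a) (hp : Monotone p), p 0 = ⊥ ∧ p n = ⊤ ∧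
    ∀ i < n, S (subquotient (hp (Nat.le_succ i))) ∨ IsZero (subquotient (hp (Nat.le_succ i)))

end Abelian

/-! ### The bounded derived category -/

section Derived

variable (C : Type u) [Category.{v} C] [Abelian C] [HasDerivedCategory.{w} C]

/-- `D^b(C)`: the full subcategory of `D(C)` of complexes with bounded cohomology. -/
abbrev Db : Type (max u v) :=
  (DerivedCategory.TStructure.t (C := C)).bounded.FullSubcategory

/-- The inclusion `D^b(C) ⥤ D(C)`. -/
abbrev Db.ι : Db C ⥤ DerivedCategory C :=
  (DerivedCategory.TStructure.t (C := C)).bounded.ι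

/-- The embedding `C ⥤ D^b(C)` as complexes concentrated in degree `0`. -/
def Db.single : C ⥤ Db C :=
  (DerivedCategory.TStructure.t (C := C)).bounded.lift (DerivedCategory.singleFunctor C 0)
    (fun _ => ⟨⟨0, inferInstance⟩, ⟨0, inferInstance⟩⟩)

/-- The cohomology functor `H^i : D^b(C) ⥤ C`. -/
def Db.homology (i : ℤ) : Db C ⥤ C :=
  Db.ι C ⋙ DerivedCategory.homologyFunctor C i

/-- `C` as a full, isomorphism-closed subcategory of `D^b(C)`. -/
def Db.heart : ObjectProperty (Db C) := (Db.single C).essImage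

end Derived

/-- `Σⁿ P`, the full subcategory of objects isomorphic to `Σⁿ x = x⟦n⟧` with `x ∈ P`. -/
def sigma {D : Type u} [Category.{v} D] [HasShift D ℤ] (n : ℤ) (P : ObjectProperty D) :
    ObjectProperty D :=
  P.map (shiftFunctor D n)

section ExactFunctor

variable {C : Type u} [Category.{v} C] [Abelian C] [HasDerivedCategory.{w} C]
  {C' : Type u'} [Category.{v} C'] [Abelian C'] [HasDerivedCategory.{w'} C']

/-- The functor `D^b(C) ⥤ D^+(C')` induced by an exact functor `C ⥤ C'`. -/
def dbToPlus (J : C ⥤ C') [J.Additive] [PreservesFiniteLimits J] [PreservesFiniteColimits J] :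
    Db C ⥤ DerivedCategory.Plus C' :=
  (DerivedCategory.TStructure.t (C := C')).plus.lift (Db.ι C ⋙ J.mapDerivedCategory) (by
    rintro ⟨X, ⟨n, hX⟩, -⟩
    obtain ⟨K, e, hK⟩ := hX.ge
    refine ⟨n, ⟨(J.mapHomologicalComplex (ComplexShape.up ℤ)).obj K,
      J.mapDerivedCategory.mapIso e ≪≫ J.mapDerivedCategoryFactors.app K, ?_⟩⟩
    infer_instance)

end ExactFunctor

/-! ### `mod (End T)ᵒᵖ` and `RHom(T, -)` -/

section ModEndOp

theorem isNoetherianRing_endOp (k : Type w') [Field k] {C : Type u} [Category.{v} C] [Abelian C]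
    [Linear k C] [∀ X Y : C, Module.Finite k (X ⟶ Y)] (T : C) :
    IsNoetherianRing (End T)ᵐᵒᵖ := by
  have h : Module.Finite k (End T) := inferInstanceAs (Module.Finite k (T ⟶ T))
  have h' : Module.Finite k (End T)ᵐᵒᵖ := Module.Finite.equiv (MulOpposite.opLinearEquiv k)
  exact isNoetherian_of_tower k inferInstance

set_option linter.unusedVariables false in
/-- `mod (End T)ᵒᵖ`: finitely generated left modules over the opposite ring of `End T`
(whose multiplication is composition, `f * g = f ∘ g`). The field `k` is only recorded
because it is the reason why `End T` is noetherian. -/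
def ModEndOp (k : Type w') [Field k] {C : Type u} [Category.{v} C] [Abelian C] [Linear k C]
    [∀ X Y : C, Module.Finite k (X ⟶ Y)] (T : C) : Type (v + 1) :=
  FGModuleCat.{v} (End T)ᵐᵒᵖ

variable (k : Type w') [Field k] {C : Type u} [Category.{v} C] [Abelian C] [Linear k C]
  [∀ X Y : C, Module.Finite k (X ⟶ Y)]

instance (T : C) : Category.{v} (ModEndOp k T) :=
  inferInstanceAs (Category.{v} (FGModuleCat.{v} (End T)ᵐᵒᵖ))

instance (T : C) : Abelian (ModEndOp k T) :=
  haveI := isNoetherianRing_endOp k T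
  inferInstanceAs (Abelian (FGModuleCat.{v} (End T)ᵐᵒᵖ))

/-- The inclusion of `mod (End T)ᵒᵖ` into the category of all `(End T)ᵒᵖ`-modules. -/
def ModEndOp.ι (T : C) : ModEndOp k T ⥤ ModuleCat.{v} (End T)ᵐᵒᵖ :=
  forget₂ (FGModuleCat.{v} (End T)ᵐᵒᵖ) (ModuleCat.{v} (End T)ᵐᵒᵖ)

instance (T : C) : (ModEndOp.ι k T).Additive where
  map_add := by intros; rfl

instance (T : C) : PreservesFiniteLimits (ModEndOp.ι k T) :=
  haveI := isNoetherianRing_endOp k T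
  inferInstanceAs (PreservesFiniteLimits
    (forget₂ (FGModuleCat.{v} (End T)ᵐᵒᵖ) (ModuleCat.{v} (End T)ᵐᵒᵖ)))

instance (T : C) : PreservesFiniteColimits (ModEndOp.ι k T) :=
  haveI := isNoetherianRing_endOp k T
  inferInstanceAs (PreservesFiniteColimits
    (forget₂ (FGModuleCat.{v} (End T)ᵐᵒᵖ) (ModuleCat.{v} (End T)ᵐᵒᵖ)))

end ModEndOp

section RHom

variable {C : Type u} [Category.{v} C] [Abelian C]
  {C' : Type u'} [Category.{v} C'] [Abelian C']

/-- The ring homomorphism `(End T)ᵒᵖ → (End (J T))ᵒᵖ` given by a functor `J`. -/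
def endOpMap (J : C ⥤ C') [J.Additive] (T : C) : (End T)ᵐᵒᵖ →+* (End (J.obj T))ᵐᵒᵖ :=
  RingHom.op
    { J.mapEnd T with
      map_zero' := J.map_zero T T
      map_add' := fun _ _ => J.map_add }

/-- The functor `Hom(J T, -) : C' ⥤ Mod (End T)ᵒᵖ`, where `End T` acts by precomposition. -/
def homFunctor (J : C ⥤ C') [J.Additive] (T : C) : C' ⥤ ModuleCat.{v} (End T)ᵐᵒᵖ :=
  preadditiveCoyonedaObj (J.obj T) ⋙ ModuleCat.restrictScalars (endOpMap J T)

instance (J : C ⥤ C') [J.Additive] (T : C) : (homFunctor J T).Additive := by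
  unfold homFunctor
  infer_instance

/-- The total right derived functor `RHom(T, -) : D^+(C') ⥤ D^+(Mod (End T)ᵒᵖ)`,
computed with injective resolutions in `C'`. -/
def rHom [EnoughInjectives C'] [HasDerivedCategory.{w₁} C'] (J : C ⥤ C') [J.Additive] (T : C)
    [HasDerivedCategory.{w₂} (ModuleCat.{v} (End T)ᵐᵒᵖ)] :
    DerivedCategory.Plus C' ⥤ DerivedCategory.Plus (ModuleCat.{v} (End T)ᵐᵒᵖ) :=
  (homFunctor J T).rightDerivedFunctorPlus

end RHom

/-! ### The classes attached to a functor `F : D^b(C) ⥤ D^b(D)` -/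

section Classes

variable {C : Type u} [Category.{v} C] [Abelian C] [HasDerivedCategory.{w} C]
  {D : Type u'} [Category.{v} D] [Abelian D] [HasDerivedCategory.{w'} D]

/-- `F⁻¹(D)`: the full subcategory of `D^b(C)` of objects sent by `F` into `D ⊆ D^b(D)`. -/
def pullbackHeart (F : Db C ⥤ Db D) : ObjectProperty (Db C) :=
  (Db.heart D).inverseImage F

/-- `𝓕ⁱ = {x ∈ C ∣ H^j(F x) = 0 for all j ≠ i}`. -/
def concentrated (F : Db C ⥤ Db D) (i : ℤ) : ObjectProperty C :=
  fun x => ∀ j : ℤ, j ≠ i → IsZero ((Db.homology D j).obj (F.obj ((Db.single C).obj x)))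

/-- `𝓔₀ = ⟨Gen 𝓕⁰⟩`, `𝓔₁ = 𝓕¹`, `𝓔₂ = ⟨Sub 𝓕²⟩`. -/
def filtClass (F : Db C ⥤ Db D) : Fin 3 → ObjectProperty C :=
  ![extClosure (gen (concentrated F 0)), concentrated F 1, extClosure (sub (concentrated F 2))]

end Classes

end JMS

end

open JMS

/-! Transport the standard t-structure of `Db (ModEndOp k T)` along `F` to a t-structure `tB` on `Db
𝒜`, whose heart is `ℬ`, and compare it with the standard one, `tA`. An object in degrees `≥ 0` has
an injective resolution in degrees `≥ 0`, so `RHom(T, -)` preserves this bound; the vanishing of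
`Ext^i(T, -)` for `i ≥ 3` controls the other side. Thus `tA^{≥0} ⊆ tB^{≥0}` and `tA^{≤0} ⊆ tB^{≤2}`
(`IsTwoTilt`). Taking orthogonals, `tB^{≤0} ⊆ tA^{≤0}` and `tB^{≥0} ⊆ tA^{≥-2}`. Each heart
therefore has amplitude in three consecutive degrees for the other t-structure, and truncating gives
the two inclusions.

For the filtration of `x`, let `p` be maximal among the subobjects in `𝓔₀`. The `tB`-truncation of
`x / p` in degrees `≤ 0` lies in both hearts; the image of its map to `x / p` would enlarge `p`, so
the truncation is zero and `y = x / p` lies in `tB^{≥1}` (`exists_subobject_gen`). Now truncate to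
`r → y → w` with `r` in `tB`-degree `1` and `w` in `tB`-degree `2`. Then `w` lies in `𝒜`, and `m =
τ_A^{≤0} r` is a subobject of `y` with `y / m` inside `w`. However, `H²F(m)` may be nonzero, so the
step is repeated with `m` in place of `y`. The length of `H¹F` drops strictly unless `m ≅ r`, so the
process stops at a subobject in `𝓕¹` with quotient in `𝓔₂` (`exists_subobject_sub`). Uniqueness is
formal from the vanishing of Homs (`filtration_le_of_orthogonal`). -/

noncomputable section

namespace JMS

/-! ### Lower cohomological bounds and derived functors. -/

section

variable {D : Type*} [Category* D] [Preadditive D] [HasZeroObject D] [HasShift D ℤ]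
  [∀ n : ℤ, (shiftFunctor D n).Additive] [Pretriangulated D] (t : Triangulated.TStructure D)

lemma isGE_iff_of_iso {X Y : D} (e : X ≅ Y) (n : ℤ) : t.IsGE X n ↔ t.IsGE Y n :=
  ⟨fun _ => t.isGE_of_iso e n, fun _ => t.isGE_of_iso e.symm n⟩

lemma isLE_iff_of_iso {X Y : D} (e : X ≅ Y) (n : ℤ) : t.IsLE X n ↔ t.IsLE Y n :=
  ⟨fun _ => t.isLE_of_iso e n, fun _ => t.isLE_of_iso e.symm n⟩

end

section LeftExactness

/-- The total right derived functor of an additive functor is left t-exact. -/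
lemma isGE_rightDerivedFunctorPlus_obj {C : Type*} {D : Type*} [Category* C] [Category* D]
    [Abelian C] [Abelian D] [HasDerivedCategory C] [HasDerivedCategory D]
    (G : C ⥤ D) [G.Additive] [EnoughInjectives C]
    (X : DerivedCategory.Plus C) (n : ℤ) [X.IsGE n] :
    (G.rightDerivedFunctorPlus.obj X).IsGE n := by
  obtain ⟨L, hL, ⟨e⟩⟩ := DerivedCategory.Plus.exists_injective_nonempty_iso X n
  let I := (InjectiveObject.ι C).mapCochainComplexPlus.obj L
  -- On a bounded below complex of injectives the derived functor is computed termwise.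
  have : IsIso (G.rightDerivedFunctorPlusUnit.app ((HomotopyCategory.Plus.quotient C).obj I)) := by
    dsimp only [I]
    infer_instance
  let e' := asIso (G.rightDerivedFunctorPlusUnit.app ((HomotopyCategory.Plus.quotient C).obj I)) ≪≫
    G.rightDerivedFunctorPlus.mapIso e
  have hI : I.obj.IsStrictlyGE n := inferInstanceAs (CochainComplex.IsStrictlyGE
    (((InjectiveObject.ι C).mapHomologicalComplex (.up ℤ)).obj L.obj) n)
  have hGI : DerivedCategory.Plus.IsGE
      ((G.mapHomotopyCategoryPlus ⋙ DerivedCategory.Plus.Qh).obj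
        ((HomotopyCategory.Plus.quotient C).obj I)) n := by
    rw [← DerivedCategory.Plus.isGE_ι_obj_iff]
    exact DerivedCategory.TStructure.t.isGE_of_iso
      ((DerivedCategory.quotientCompQhIso D).symm.app
        ((G.mapHomologicalComplex (.up ℤ)).obj I.obj)) n
  exact DerivedCategory.Plus.TStructure.t.isGE_of_iso e' n

/-- An exact faithful functor detects the lower bound of the cohomology. -/
lemma isGE_mapDerivedCategory_obj_iff {C : Type*} {D : Type*} [Category* C] [Category* D]
    [Abelian C] [Abelian D] [HasDerivedCategory C] [HasDerivedCategory D]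
    (G : C ⥤ D) [G.Additive] [PreservesFiniteLimits G] [PreservesFiniteColimits G] [G.Faithful]
    (X : DerivedCategory C) (n : ℤ) :
    (G.mapDerivedCategory.obj X).IsGE n ↔ X.IsGE n := by
  obtain ⟨K, ⟨e⟩⟩ : ∃ K, Nonempty (DerivedCategory.Q.obj K ≅ X) :=
    ⟨_, ⟨DerivedCategory.Q.objObjPreimageIso X⟩⟩
  let e' := G.mapDerivedCategory.mapIso e.symm ≪≫ G.mapDerivedCategoryFactors.app K
  have h₁ : (G.mapDerivedCategory.obj X).IsGE n ↔
      (DerivedCategory.Q.obj ((G.mapHomologicalComplex (.up ℤ)).obj K)).IsGE n :=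
    isGE_iff_of_iso DerivedCategory.TStructure.t e' n
  have h₂ : X.IsGE n ↔ (DerivedCategory.Q.obj K).IsGE n :=
    isGE_iff_of_iso DerivedCategory.TStructure.t e.symm n
  rw [h₁, h₂, DerivedCategory.isGE_Q_obj_iff, DerivedCategory.isGE_Q_obj_iff,
    CochainComplex.isGE_iff, CochainComplex.isGE_iff]
  exact forall₂_congr fun i _ => (K.sc i).exact_map_iff_of_faithful G

end LeftExactness

section

variable (k : Type w') [Field k] {C : Type u} [Category.{v} C] [Abelian C] [Linear k C]
  [∀ X Y : C, Module.Finite k (X ⟶ Y)]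

instance (T : C) : (ModEndOp.ι k T).Faithful :=
  inferInstanceAs (forget₂ (FGModuleCat.{v} (End T)ᵐᵒᵖ) (ModuleCat.{v} (End T)ᵐᵒᵖ)).Faithful

end

/-! ### The standard t-structure on `D^b` and left t-exactness of `RHom(T, -)`. -/

/-- The standard t-structure on the bounded derived category. -/
abbrev Db.t (C : Type u) [Category.{v} C] [Abelian C] [HasDerivedCategory.{w} C] :
    Triangulated.TStructure (Db C) :=
  (DerivedCategory.TStructure.t (C := C)).onBounded

section

variable {C : Type u} [Category.{v} C] [Abelian C] [HasDerivedCategory.{w} C]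

lemma Db.isGE_iff (X : Db C) (n : ℤ) :
    (Db.t C).IsGE X n ↔ ∀ i < n, IsZero ((Db.homology C i).obj X) := by
  rw [ObjectProperty.tStructure_isGE_iff]
  exact DerivedCategory.isGE_iff X.obj n

lemma Db.isLE_iff (X : Db C) (n : ℤ) :
    (Db.t C).IsLE X n ↔ ∀ i > n, IsZero ((Db.homology C i).obj X) := by
  rw [ObjectProperty.tStructure_isLE_iff]
  exact DerivedCategory.isLE_iff X.obj n

instance : (Db.single C).Full where
  map_surjective f := by
    obtain ⟨g, hg⟩ := (DerivedCategory.singleFunctor C 0).map_surjective f.hom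
    exact ⟨g, (Db.ι C).map_injective hg⟩

instance : (Db.single C).Faithful where
  map_injective h :=
    (DerivedCategory.singleFunctor C 0).map_injective ((Db.ι C).congr_map h)

instance : (Db.single C).Additive where
  map_add := (Db.ι C).map_injective ((DerivedCategory.singleFunctor C 0).map_add)

lemma Db.heart_eq : Db.heart C = (Db.t C).heart := by
  ext X
  rw [Triangulated.TStructure.mem_heart_iff]
  constructor
  · rintro ⟨Y, ⟨e⟩⟩
    have h₀ : (Db.t C).IsGE ((Db.single C).obj Y) 0 := by
      rw [ObjectProperty.tStructure_isGE_iff]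
      exact inferInstanceAs (((DerivedCategory.singleFunctor C 0).obj Y).IsGE 0)
    have h₁ : (Db.t C).IsLE ((Db.single C).obj Y) 0 := by
      rw [ObjectProperty.tStructure_isLE_iff]
      exact inferInstanceAs (((DerivedCategory.singleFunctor C 0).obj Y).IsLE 0)
    exact ⟨(Db.t C).isLE_of_iso e 0, (Db.t C).isGE_of_iso e 0⟩
  · rintro ⟨h₁, h₂⟩
    rw [ObjectProperty.tStructure_isLE_iff] at h₁
    rw [ObjectProperty.tStructure_isGE_iff] at h₂
    obtain ⟨Y, ⟨e⟩⟩ := DerivedCategory.exists_iso_singleFunctor_obj_of_isGE_of_isLE X.obj 0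
    exact ⟨Y, ⟨(Db.ι C).preimageIso e.symm⟩⟩

end

/-- `RHom(T, -)` restricted to `D^b` is left t-exact. -/
lemma isGE_obj_of_iso_rHom
    (k : Type w) [Field k]
    {𝒜 : Type u} [Category.{v} 𝒜] [Abelian 𝒜] [Linear k 𝒜] [∀ X Y : 𝒜, Module.Finite k (X ⟶ Y)]
    {𝒜' : Type u'} [Category.{v} 𝒜'] [Abelian 𝒜'] [EnoughInjectives 𝒜']
    (J : 𝒜 ⥤ 𝒜') [J.Faithful] [J.Additive]
    [PreservesFiniteLimits J] [PreservesFiniteColimits J]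
    (T : 𝒜)
    [HasDerivedCategory.{w₁} 𝒜] [HasDerivedCategory.{w₂} 𝒜']
    [HasDerivedCategory.{w₃} (ModEndOp k T)]
    [HasDerivedCategory.{w₄} (ModuleCat.{v} (End T)ᵐᵒᵖ)]
    (F : Db 𝒜 ⥤ Db (ModEndOp k T))
    (e : F ⋙ dbToPlus (ModEndOp.ι k T) ≅ dbToPlus J ⋙ rHom J T)
    (X : Db 𝒜) (n : ℤ) (hX : (Db.t 𝒜).IsGE X n) :
    (Db.t (ModEndOp k T)).IsGE (F.obj X) n := by
  rw [ObjectProperty.tStructure_isGE_iff] at hX ⊢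
  have h₁ : ((dbToPlus J).obj X).IsGE n := by
    rw [← DerivedCategory.Plus.isGE_ι_obj_iff]
    exact (isGE_mapDerivedCategory_obj_iff J X.obj n).2 hX
  have h₂ := isGE_rightDerivedFunctorPlus_obj (homFunctor J T) ((dbToPlus J).obj X) n
  have h₃ : ((dbToPlus (ModEndOp.ι k T)).obj (F.obj X)).IsGE n :=
    (isGE_iff_of_iso DerivedCategory.Plus.TStructure.t (e.app X) n).2 h₂
  rw [← DerivedCategory.Plus.isGE_ι_obj_iff] at h₃
  exact (isGE_mapDerivedCategory_obj_iff (ModEndOp.ι k T) (F.obj X).obj n).1 h₃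

/-! ### Pulled-back t-structures, truncation and dévissage. -/

section

variable {D : Type*} [Category* D] [Preadditive D] [HasZeroObject D] [HasShift D ℤ]
  [∀ n : ℤ, (shiftFunctor D n).Additive] [Pretriangulated D]

/-- The preimage of a t-structure under a triangulated equivalence. -/
def tStructurePullback {D' : Type*} [Category* D'] [Preadditive D'] [HasZeroObject D']
    [HasShift D' ℤ] [∀ n : ℤ, (shiftFunctor D' n).Additive] [Pretriangulated D']
    (F : D ⥤ D') [F.CommShift ℤ] [F.IsTriangulated] [F.IsEquivalence]
    (t : Triangulated.TStructure D') : Triangulated.TStructure D where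
  le n X := t.le n (F.obj X)
  ge n X := t.ge n (F.obj X)
  le_isClosedUnderIsomorphisms n := ⟨fun e h => (t.le n).prop_of_iso (F.mapIso e) h⟩
  ge_isClosedUnderIsomorphisms n := ⟨fun e h => (t.ge n).prop_of_iso (F.mapIso e) h⟩
  le_shift n a n' h X hX := (t.le n').prop_of_iso ((F.commShiftIso a).symm.app X)
    (t.le_shift n a n' h _ hX)
  ge_shift n a n' h X hX := (t.ge n').prop_of_iso ((F.commShiftIso a).symm.app X)
    (t.ge_shift n a n' h _ hX)
  zero' X Y f hX hY := F.map_injective (by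
    rw [F.map_zero]
    exact t.zero' _ hX hY)
  le_zero_le X hX := t.le_zero_le _ hX
  ge_one_le X hX := t.ge_one_le _ hX
  -- A truncation triangle of `F.obj A` lifts because `F` is full, essentially surjective and
  -- reflects distinguished triangles.
  exists_triangle_zero_one A := by
    obtain ⟨X, Y, hX, hY, f, g, h, hT⟩ := t.exists_triangle_zero_one (F.obj A)
    let e₁ := F.objObjPreimageIso X
    let e₃ := F.objObjPreimageIso Y
    refine ⟨F.objPreimage X, F.objPreimage Y, (t.le 0).prop_of_iso e₁.symm hX,
      (t.ge 1).prop_of_iso e₃.symm hY, F.preimage (e₁.hom ≫ f), F.preimage (g ≫ e₃.inv),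
      F.preimage (e₃.hom ≫ h ≫ e₁.inv⟦1⟧' ≫ (F.commShiftIso (1 : ℤ)).inv.app _), ?_⟩
    rw [← F.map_distinguished_iff]
    refine isomorphic_distinguished _ hT _ (Triangle.isoMk _ _ e₁ (Iso.refl _) e₃ ?_ ?_ ?_)
    · change F.map (F.preimage _) ≫ 𝟙 _ = e₁.hom ≫ f
      rw [F.map_preimage, Category.comp_id]
    · change F.map (F.preimage _) ≫ e₃.hom = 𝟙 _ ≫ g
      simp
    · change (F.map (F.preimage _) ≫ (F.commShiftIso (1 : ℤ)).hom.app _) ≫ e₁.hom⟦1⟧' =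
        e₃.hom ≫ h
      simp [← Functor.map_comp]

variable (t : Triangulated.TStructure D)

/-- `X` is an extension of `Y` by `Z⟦-1⟧`, which lives one degree above `Z`; hence the slack in `n ≤
m + 1`. -/
lemma isGE₁ {X Y Z : D} {f : X ⟶ Y} {g : Y ⟶ Z} {h : Z ⟶ X⟦(1 : ℤ)⟧}
    (hT : Triangle.mk f g h ∈ distTriang D) (n m : ℤ) (hY : t.IsGE Y n) (hZ : t.IsGE Z m)
    (hm : n ≤ m + 1 := by lia) : t.IsGE X n := by
  have := t.isGE_shift Z m (-1) (m + 1)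
  exact t.isGE₂ _ (inv_rot_of_distTriang _ hT) n (t.isGE_of_ge (Z⟦(-1 : ℤ)⟧) n (m + 1) hm) hY

lemma isLE₃ {X Y Z : D} {f : X ⟶ Y} {g : Y ⟶ Z} {h : Z ⟶ X⟦(1 : ℤ)⟧}
    (hT : Triangle.mk f g h ∈ distTriang D) (n m : ℤ) (hX : t.IsLE X m) (hY : t.IsLE Y n)
    (hm : m ≤ n + 1 := by lia) : t.IsLE Z n := by
  have := t.isLE_shift X m 1 (m - 1)
  exact t.isLE₂ _ (rot_of_distTriang _ hT) n hY (t.isLE_of_le (X⟦(1 : ℤ)⟧) (m - 1) n (by lia))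

lemma exists_truncation (X : D) (n : ℤ) :
    ∃ (Y Z : D) (f : Y ⟶ X) (g : X ⟶ Z) (h : Z ⟶ Y⟦(1 : ℤ)⟧),
      Triangle.mk f g h ∈ distTriang D ∧ t.IsLE Y n ∧ t.IsGE Z (n + 1) := by
  obtain ⟨Y, Z, hY, hZ, f, g, h, hT⟩ := t.exists_triangle X n _ rfl
  exact ⟨Y, Z, f, g, h, hT, ⟨hY⟩, ⟨hZ⟩⟩

/-- The objects concentrated in degree `n` for a t-structure. -/
def pure (n : ℤ) : ObjectProperty D := t.ge n ⊓ t.le n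

lemma pure_iff (n : ℤ) (X : D) : pure t n X ↔ t.IsGE X n ∧ t.IsLE X n := by
  simp [pure]

instance (n : ℤ) : (pure t n).IsClosedUnderIsomorphisms := by
  unfold pure
  infer_instance

lemma sigma_heart (n m : ℤ) (h : n + m = 0) : sigma n t.heart = pure t m := by
  ext X
  rw [sigma, pure_iff, ObjectProperty.prop_map_iff]
  constructor
  · rintro ⟨Y, hY, ⟨e⟩⟩
    obtain ⟨h₁, h₂⟩ := (t.mem_heart_iff Y).1 hY
    have := t.isGE_shift Y 0 n m
    have := t.isLE_shift Y 0 n m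
    exact ⟨t.isGE_of_iso e m, t.isLE_of_iso e m⟩
  · rintro ⟨h₁, h₂⟩
    refine ⟨X⟦m⟧, (t.mem_heart_iff _).2 ⟨t.isLE_shift X m m 0, t.isGE_shift X m m 0⟩, ⟨?_⟩⟩
    exact (shiftFunctorCompIsoId D m n (by lia)).app X

/-- Truncating at `b` keeps both pieces within the amplitude `[a, c]`; the slack in `hab` and `hbc`
is that of `isGE₁` and `isLE₃`. -/
lemma extensionProduct_of_isGE_of_isLE {P Q : ObjectProperty D} (X : D) (a b c : ℤ)
    [t.IsGE X a] [t.IsLE X c]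
    (hP : ∀ Y, t.IsGE Y a → t.IsLE Y b → P Y) (hQ : ∀ Y, t.IsGE Y (b + 1) → t.IsLE Y c → Q Y)
    (hab : a ≤ b + 2 := by lia) (hbc : b ≤ c + 1 := by lia) :
    P.extensionProduct Q X := by
  obtain ⟨Y, Z, f, g, h, hT, hY, hZ⟩ := exists_truncation t X b
  have hY' : t.IsGE Y a := isGE₁ t hT a (b + 1) inferInstance hZ
  have hZ' : t.IsLE Z c := isLE₃ t hT c b hY inferInstance
  exact ⟨Y, Z, f, g, h, hT, hP Y hY' hY, hQ Z hZ hZ'⟩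

/-- Dévissage of an object of amplitude `[a, a + 2]`. -/
lemma extensionProduct_pure (X : D) (a : ℤ) [t.IsGE X a] [t.IsLE X (a + 2)] :
    ((pure t a).extensionProduct (pure t (a + 1))).extensionProduct (pure t (a + 2)) X := by
  refine extensionProduct_of_isGE_of_isLE t X a (a + 1) (a + 2) ?_ ?_
  · intro Y _ _
    exact extensionProduct_of_isGE_of_isLE t Y a a (a + 1)
      (fun Z h h' => (pure_iff ..).2 ⟨h, h'⟩) (fun Z h h' => (pure_iff ..).2 ⟨h, h'⟩)
  · intro Z h h'
    exact (pure_iff ..).2 ⟨(by ring : a + 1 + 1 = a + 2) ▸ h, h'⟩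

lemma devissage (P : ObjectProperty D) [P.IsClosedUnderIsomorphisms] [P.IsTriangulatedClosed₂]
    (a : ℤ) (n : ℕ) (hP : ∀ i, a ≤ i → i ≤ a + n → pure t i ≤ P)
    (X : D) (h₁ : t.IsGE X a) (h₂ : t.IsLE X (a + n)) : P X := by
  induction n generalizing X with
  | zero => exact hP a le_rfl (by simp) X ((pure_iff ..).2 ⟨h₁, by simpa using h₂⟩)
  | succ n ih =>
    obtain ⟨Y, Z, f, g, h, hT, hY, hZ⟩ := extensionProduct_of_isGE_of_isLE t X a (a + n)
      (a + (n + 1 : ℕ)) (P := P) (Q := P)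
      (fun Y hY hY' => ih (fun i hi hi' => hP i hi (by push_cast; lia)) Y hY hY')
      (fun Y hY hY' => hP (a + n + 1) (by lia) (by push_cast; lia) Y
        ((pure_iff ..).2 ⟨hY, by push_cast at hY'; rwa [add_assoc]⟩))
    exact P.ext_of_isTriangulatedClosed₂ _ hT hY hZ

end

/-! ### Comparison of two t-structures. -/

section

variable {D : Type*} [Category* D] [Preadditive D] [HasZeroObject D] [HasShift D ℤ]
  [∀ n : ℤ, (shiftFunctor D n).Additive] [Pretriangulated D]

/-- The t-structure `tB` is obtained from `tA` by tilting in amplitude `[0, 2]`. -/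
structure IsTwoTilt (tA tB : Triangulated.TStructure D) : Prop where
  ge_zero (X : D) (h : tA.IsGE X 0) : tB.IsGE X 0
  le_zero (X : D) (h : tA.IsLE X 0) : tB.IsLE X 2

variable {tA tB : Triangulated.TStructure D} (h : IsTwoTilt tA tB)

include h

namespace IsTwoTilt

lemma isGE (X : D) (n : ℤ) [tA.IsGE X n] : tB.IsGE X n := by
  have := tA.isGE_shift X n n 0
  have := h.ge_zero (X⟦n⟧) this
  exact tB.isGE_of_shift X n n 0

lemma isLE (X : D) (n m : ℤ) (hm : n + 2 = m := by lia) [tA.IsLE X n] : tB.IsLE X m := by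
  have := tA.isLE_shift X n n 0
  have := h.le_zero (X⟦n⟧) this
  exact tB.isLE_of_shift X m n 2

/-- Aisles are left orthogonals of coaisles, so an inclusion of coaisles reverses to one of aisles.
-/
lemma isLE' (X : D) (n : ℤ) [tB.IsLE X n] : tA.IsLE X n := by
  rw [tA.isLE_iff_orthogonal n (n + 1) rfl]
  intro Y f _
  have := h.isGE Y (n + 1)
  exact tB.zero f n (n + 1)

lemma isGE' (X : D) (n m : ℤ) (hm : m + 2 = n := by lia) [tB.IsGE X n] : tA.IsGE X m := by
  rw [tA.isGE_iff_orthogonal (m - 1) m (by lia)]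
  intro Y f _
  have := h.isLE Y (m - 1) (m + 1)
  exact tB.zero f (m + 1) n

end IsTwoTilt

end

/-! ### Subquotients and extension closures in an abelian category. -/

section

variable {C : Type u} [Category.{v} C] [Abelian C]

/-- The projection `q ↠ q / p`. -/
def subquotientπ {x : C} {p q : Subobject x} (h : p ≤ q) : (q : C) ⟶ subquotient h :=
  cokernel.π (Subobject.ofLE p q h)

lemma ofLE_comp_subquotientπ {x : C} {p q : Subobject x} (h : p ≤ q) :
    Subobject.ofLE p q h ≫ subquotientπ h = 0 :=
  cokernel.condition _

lemma shortExact_subquotient {x : C} {p q : Subobject x} (h : p ≤ q) :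
    (ShortComplex.mk _ _ (ofLE_comp_subquotientπ h)).ShortExact :=
  { exact := ShortComplex.exact_cokernel _
    epi_g := inferInstanceAs (Epi (cokernel.π (Subobject.ofLE p q h))) }

instance {x : C} {p q : Subobject x} (h : p ≤ q) : Epi (subquotientπ h) :=
  (shortExact_subquotient h).epi_g

lemma comp_subquotientπ_eq_zero_iff {x : C} {p q : Subobject x} (h : p ≤ q) {a : C}
    (f : a ⟶ (q : C)) : f ≫ subquotientπ h = 0 ↔ p.Factors (f ≫ q.arrow) := by
  constructor
  · intro hf
    have hS := shortExact_subquotient h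
    let l := hS.exact.lift f hf
    have hl : l ≫ Subobject.ofLE p q h = f := hS.exact.lift_f f hf
    rw [← hl, Category.assoc, Subobject.ofLE_arrow]
    exact Subobject.factors_comp_arrow l
  · intro hf
    have : f = p.factorThru _ hf ≫ Subobject.ofLE p q h := by
      rw [← cancel_mono q.arrow]
      simp
    rw [this, Category.assoc, ofLE_comp_subquotientπ, comp_zero]

/-- A morphism between subobjects which is compatible with two inclusions `p ≤ q` and `p' ≤ q'`
in the sense of the universal property of quotients induces an isomorphism on subquotients. -/
lemma nonempty_subquotient_iso {x x' : C} {p q : Subobject x} {p' q' : Subobject x'}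
    (h : p ≤ q) (h' : p' ≤ q') (e : (q : C) ⟶ (q' : C)) [Epi e]
    (he : ∀ {a : C} (f : a ⟶ (q : C)), p.Factors (f ≫ q.arrow) ↔ p'.Factors (f ≫ e ≫ q'.arrow)) :
    Nonempty (subquotient h ≅ subquotient h') := by
  let π : (q : C) ⟶ subquotient h' := e ≫ subquotientπ h'
  -- By `he`, the kernel of `π` is `p`.
  have hπ {a : C} (f : a ⟶ (q : C)) : f ≫ π = 0 ↔ p.Factors (f ≫ q.arrow) := by
    rw [he, ← Category.assoc, ← Category.assoc, comp_subquotientπ_eq_zero_iff h']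
  have hw : Subobject.ofLE p q h ≫ π = 0 := by
    rw [hπ, Subobject.ofLE_arrow]
    exact p.factors_self
  have : Epi π := epi_comp _ _
  have hS : (ShortComplex.mk _ π hw).ShortExact :=
    { exact := ShortComplex.exact_of_f_is_kernel _ (KernelFork.IsLimit.ofι' _ _ fun f hf => by
        have hf' := (hπ f).1 hf
        refine ⟨p.factorThru _ hf', ?_⟩
        rw [← cancel_mono q.arrow]
        simp) }
  exact ⟨IsColimit.coconePointUniqueUpToIso (shortExact_subquotient h).gIsCokernel
    hS.gIsCokernel⟩

lemma nonempty_subquotient_map_iso {x y : C} (f : x ⟶ y) [Mono f] {p q : Subobject x} (h : p ≤ q)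
    (h' : (Subobject.map f).obj p ≤ (Subobject.map f).obj q) :
    Nonempty (subquotient h ≅ subquotient h') := by
  have hmap (r : Subobject x) {a : C} (g : a ⟶ x) :
      ((Subobject.map f).obj r).Factors (g ≫ f) ↔ r.Factors g := by
    have hr : (Subobject.map f).obj r = Subobject.mk (r.arrow ≫ f) := by
      conv_lhs => rw [← Subobject.mk_arrow r, Subobject.map_mk]
    rw [hr]
    constructor
    · intro hg
      let l := (Subobject.mk (r.arrow ≫ f)).factorThru _ hg ≫ (Subobject.underlyingIso _).hom
      have hl : l ≫ r.arrow ≫ f = g ≫ f := by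
        simp only [l, Category.assoc, Subobject.underlyingIso_hom_comp_eq_mk,
          Subobject.factorThru_arrow]
      rw [← Category.assoc, cancel_mono] at hl
      rw [← hl]
      exact Subobject.factors_comp_arrow l
    · intro hg
      rw [← Subobject.factorThru_arrow r g hg, Category.assoc]
      exact Subobject.factors_of_factors_right _ (Subobject.mk_factors_self _)
  have hq : (Subobject.map f).obj q = Subobject.mk (q.arrow ≫ f) := by
    conv_lhs => rw [← Subobject.mk_arrow q, Subobject.map_mk]
  let e : (q : C) ≅ ((Subobject.map f).obj q : C) :=
    (Subobject.underlyingIso (q.arrow ≫ f)).symm ≪≫ Subobject.isoOfEq _ _ hq.symm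
  have he : e.hom ≫ ((Subobject.map f).obj q).arrow = q.arrow ≫ f := by
    simp [e, Subobject.isoOfEq]
  exact nonempty_subquotient_iso h h' e.hom fun g => by
    rw [he, ← Category.assoc, hmap]

lemma factors_pullback_iff {x y : C} (f : x ⟶ y) (r : Subobject y) {a : C} (g : a ⟶ x) :
    ((Subobject.pullback f).obj r).Factors g ↔ r.Factors (g ≫ f) := by
  have sq := Subobject.isPullback f r
  constructor
  · intro hg
    rw [← Subobject.factorThru_arrow _ g hg, Category.assoc, ← sq.w, ← Category.assoc]
    exact Subobject.factors_comp_arrow _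
  · intro hg
    rw [← sq.lift_snd (r.factorThru _ hg) g (by simp)]
    exact Subobject.factors_comp_arrow _

lemma isZero_bot (x : C) : IsZero ((⊥ : Subobject x) : C) :=
  (isZero_zero C).of_iso Subobject.botCoeIsoZero

/-- Both sides are the kernel of `S.g`. This glues a filtration of `S.X₁` to one of `S.X₃` at their
junction. -/
lemma pullback_bot_eq_mk {S : ShortComplex C} (hS : S.Exact) [Mono S.f] :
    (Subobject.pullback S.g).obj ⊥ = Subobject.mk S.f := by
  refine le_antisymm (Subobject.le_of_factors ?_) (Subobject.le_of_factors ?_)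
  · have h0 := (factors_pullback_iff S.g ⊥ _).1 (Subobject.factors_self _)
    have h1 := Subobject.factorThru_arrow _ _ h0
    rw [(isZero_bot S.X₃).eq_of_src (⊥ : Subobject S.X₃).arrow 0, comp_zero] at h1
    rw [Subobject.mk_factors_iff]
    exact ⟨hS.lift _ h1.symm, hS.lift_f _ h1.symm⟩
  · rw [factors_pullback_iff, ← Subobject.underlyingIso_hom_comp_eq_mk, Category.assoc, S.zero,
      comp_zero]
    exact Subobject.factors_zero

lemma nonempty_subquotient_pullback_iso {x y : C} (f : x ⟶ y) [Epi f] {p q : Subobject y}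
    (h : p ≤ q) (h' : (Subobject.pullback f).obj p ≤ (Subobject.pullback f).obj q) :
    Nonempty (subquotient h' ≅ subquotient h) := by
  have sq := Subobject.isPullback f q
  have : Epi (Subobject.pullbackπ f q) := by
    rw [← sq.isoPullback_hom_fst]
    infer_instance
  exact nonempty_subquotient_iso h' h (Subobject.pullbackπ f q) fun g => by
    rw [factors_pullback_iff, sq.w, Category.assoc]

/-- Objects of the extension closure are obtained from zero by iterated extensions. -/
lemma extClosure_le {S P : ObjectProperty C} [P.IsClosedUnderIsomorphisms]
    [P.IsClosedUnderExtensions] (h₀ : ∀ z, IsZero z → P z) (hS : S ≤ P) : extClosure S ≤ P := by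
  rintro a ⟨n, p, hp, hp₀, hpn, hsub⟩
  have key : ∀ i ≤ n, P (p i : C) := by
    intro i
    induction i with
    | zero =>
      intro _
      rw [hp₀]
      exact h₀ _ (isZero_bot a)
    | succ i ih =>
      intro hi
      refine P.prop_X₂_of_shortExact (shortExact_subquotient (hp (Nat.le_succ i)))
        (ih (by lia)) ?_
      exact (hsub i (by lia)).elim (fun h => hS _ h) (fun h => h₀ _ h)
  have h := key n le_rfl
  rw [hpn] at h
  exact P.prop_of_iso (asIso (⊤ : Subobject a).arrow) h

lemma extClosure_of_isZero (S : ObjectProperty C) (z : C) (hz : IsZero z) : extClosure S z := by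
  have := Subobject.subsingleton_of_isZero hz
  exact ⟨0, fun _ => ⊥, monotone_const, rfl, Subsingleton.elim _ _, by simp⟩

lemma subquotient_prop_congr (P : ObjectProperty C) {x : C} {p q p' q' : Subobject x} (h : p ≤ q)
    (hp : p = p') (hq : q = q') (h' : p' ≤ q') (hP : P (subquotient h')) : P (subquotient h) := by
  subst hp hq
  exact hP

/-- Push the filtration of the subobject forward, pull that of the quotient back, and concatenate.
-/
instance extClosure_isClosedUnderExtensions (S : ObjectProperty C) [S.IsClosedUnderIsomorphisms] :
    (extClosure S).IsClosedUnderExtensions where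
  prop_X₂_of_shortExact := by
    rintro X hX ⟨n, p, hp, hp₀, hpn, hps⟩ ⟨m, q, hq, hq₀, hqm, hqs⟩
    have := hX.mono_f
    have := hX.epi_g
    let S' : ObjectProperty C := S ⊔ IsZero
    have hS' : S'.IsClosedUnderIsomorphisms := ⟨fun e h =>
      h.elim (fun h => Or.inl (S.prop_of_iso e h)) (fun h => Or.inr (h.of_iso e.symm))⟩
    let r : ℕ → Subobject X.X₂ := fun i =>
      if i ≤ n then (Subobject.map X.f).obj (p i) else (Subobject.pullback X.g).obj (q (i - n))
    -- At `i = n` both descriptions of `r i` hold, since the image of `X.f` is the kernel of `X.g`.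
    have hr₁ (i : ℕ) (hi : i ≤ n) : r i = (Subobject.map X.f).obj (p i) := if_pos hi
    have hr₂ (i : ℕ) (hi : n ≤ i) : r i = (Subobject.pullback X.g).obj (q (i - n)) := by
      obtain rfl | hi' := hi.eq_or_lt
      · rw [hr₁ n le_rfl, Nat.sub_self, hpn, hq₀, Subobject.map_top, pullback_bot_eq_mk hX.exact]
      · exact if_neg (by lia)
    have hr : Monotone r := by
      refine monotone_nat_of_le_succ fun i => ?_
      by_cases hi : i + 1 ≤ n
      · rw [hr₁ i (by lia), hr₁ (i + 1) hi]
        exact (Subobject.map X.f).monotone (hp (Nat.le_succ i))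
      · rw [hr₂ i (by lia), hr₂ (i + 1) (by lia)]
        exact (Subobject.pullback X.g).monotone (hq (by lia))
    refine ⟨n + m, r, hr, ?_, ?_, fun i hi => ?_⟩
    · rw [hr₁ 0 (Nat.zero_le _), hp₀, Subobject.map_bot]
    · rw [hr₂ (n + m) (by lia), Nat.add_sub_cancel_left, hqm, Subobject.pullback_top]
    · change S' _
      by_cases hi' : i + 1 ≤ n
      · refine subquotient_prop_congr S' _ (hr₁ i (by lia)) (hr₁ (i + 1) hi')
          ((Subobject.map X.f).monotone (hp (Nat.le_succ i))) ?_
        obtain ⟨e⟩ := nonempty_subquotient_map_iso X.f (hp (Nat.le_succ i))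
          ((Subobject.map X.f).monotone (hp (Nat.le_succ i)))
        exact S'.prop_of_iso e (hps i (by lia))
      · refine subquotient_prop_congr S' _ (hr₂ i (by lia))
          ((hr₂ (i + 1) (by lia)).trans (by rw [Nat.succ_sub (by lia)]))
          ((Subobject.pullback X.g).monotone (hq (Nat.le_succ (i - n)))) ?_
        obtain ⟨e⟩ := nonempty_subquotient_pullback_iso X.g (hq (Nat.le_succ (i - n)))
          ((Subobject.pullback X.g).monotone (hq (Nat.le_succ (i - n))))
        exact S'.prop_of_iso e.symm (hqs (i - n) (by lia))

-- An isomorphism `X ≅ Y` gives a short exact sequence `X → Y → 0`.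
open ZeroObject in
lemma isClosedUnderIsomorphisms_of_isClosedUnderExtensions (P : ObjectProperty C)
    [P.IsClosedUnderExtensions] (h₀ : ∀ z, IsZero z → P z) : P.IsClosedUnderIsomorphisms where
  of_iso {X Y} e hX := by
    refine P.prop_X₂_of_shortExact (S := ShortComplex.mk e.hom (0 : Y ⟶ (0 : C)) comp_zero) ?_ hX
      (h₀ _ (isZero_zero C))
    exact { exact := (ShortComplex.exact_iff_epi _ rfl).2 (inferInstanceAs (Epi e.hom))
            mono_f := inferInstanceAs (Mono e.hom)
            epi_g := (isZero_zero C).epi _ }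

instance extClosure_isClosedUnderIsomorphisms (S : ObjectProperty C)
    [S.IsClosedUnderIsomorphisms] : (extClosure S).IsClosedUnderIsomorphisms :=
  isClosedUnderIsomorphisms_of_isClosedUnderExtensions _ (extClosure_of_isZero S)

/-- The subquotient `p / 0` is `p`. -/
def subquotientBotIso {x : C} (p : Subobject x) : (p : C) ≅ subquotient (bot_le : ⊥ ≤ p) :=
  haveI : Mono (subquotientπ (bot_le : ⊥ ≤ p)) :=
    (ShortComplex.exact_iff_mono _ ((isZero_bot x).eq_of_src _ _)).1
      (shortExact_subquotient bot_le).exact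
  haveI : IsIso (subquotientπ (bot_le : ⊥ ≤ p)) := isIso_of_mono_of_epi _
  asIso (subquotientπ (bot_le : ⊥ ≤ p))

/-- The subquotient `x / p` is the cokernel of the inclusion of `p`. -/
lemma nonempty_subquotient_top_iso {x : C} (p : Subobject x) :
    Nonempty (subquotient (le_top : p ≤ ⊤) ≅ cokernel p.arrow) :=
  ⟨cokernel.mapIso _ _ (Iso.refl _) (asIso (⊤ : Subobject x).arrow) (by simp)⟩

lemma le_extClosure (S : ObjectProperty C) [S.IsClosedUnderIsomorphisms] : S ≤ extClosure S := by
  intro x hx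
  let p : ℕ → Subobject x := fun i => if i = 0 then ⊥ else ⊤
  have hp : Monotone p := monotone_nat_of_le_succ fun i => by simp [p]
  refine ⟨1, p, hp, if_pos rfl, if_neg one_ne_zero, fun i hi => Or.inl ?_⟩
  obtain rfl : i = 0 := by lia
  refine subquotient_prop_congr S _ (if_pos rfl) (if_neg (by simp)) (bot_le : ⊥ ≤ ⊤) ?_
  exact S.prop_of_iso ((asIso (⊤ : Subobject x).arrow).symm ≪≫ subquotientBotIso ⊤) hx

instance (S : ObjectProperty C) : (gen S).IsClosedUnderIsomorphisms where
  of_iso := by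
    rintro x y e ⟨s, hs, f, hf⟩
    exact ⟨s, hs, f ≫ e.hom, epi_comp _ _⟩

instance (S : ObjectProperty C) : (sub S).IsClosedUnderIsomorphisms where
  of_iso := by
    rintro x y e ⟨s, hs, f, hf⟩
    exact ⟨s, hs, e.inv ≫ f, mono_comp _ _⟩

/-! ### Orthogonality and uniqueness of filtrations. -/

/-- The left orthogonal of an object. -/
def homLeft (y : C) : ObjectProperty C := fun x => ∀ f : x ⟶ y, f = 0

/-- The right orthogonal of an object. -/
def homRight (x : C) : ObjectProperty C := fun y => ∀ f : x ⟶ y, f = 0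

instance (y : C) : (homLeft y).IsClosedUnderExtensions where
  prop_X₂_of_shortExact {S} hS h₁ h₃ f := by
    have := hS.epi_g
    rw [← hS.exact.g_desc f (h₁ _), h₃ (hS.exact.desc f (h₁ _)), comp_zero]

instance (x : C) : (homRight x).IsClosedUnderExtensions where
  prop_X₂_of_shortExact {S} hS h₁ h₃ f := by
    have := hS.mono_f
    rw [← hS.exact.lift_f f (h₃ _), h₁ (hS.exact.lift f (h₃ _)), zero_comp]

/-- A left orthogonal contains zero and is closed under quotients and extensions. -/
lemma homLeft_extClosure_gen {S : ObjectProperty C} {y : C} (h : S ≤ homLeft y) :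
    extClosure (gen S) ≤ homLeft y := by
  have := isClosedUnderIsomorphisms_of_isClosedUnderExtensions (homLeft y)
    (fun z hz f => hz.eq_of_src f 0)
  refine extClosure_le (fun z hz f => hz.eq_of_src f 0) ?_
  rintro x ⟨s, hs, g, hg⟩ f
  rw [← cancel_epi g, comp_zero]
  exact h s hs _

lemma homRight_extClosure_sub {S : ObjectProperty C} {x : C} (h : S ≤ homRight x) :
    extClosure (sub S) ≤ homRight x := by
  have := isClosedUnderIsomorphisms_of_isClosedUnderExtensions (homRight x)
    (fun z hz f => hz.eq_of_tgt f 0)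
  refine extClosure_le (fun z hz f => hz.eq_of_tgt f 0) ?_
  rintro y ⟨s, hs, g, hg⟩ f
  rw [← cancel_mono g, zero_comp]
  exact h s hs _

/-- Filtrations with subquotients in three orthogonal classes are unique. -/
lemma filtration_le_of_orthogonal {P₀ P₁ P₂ : ObjectProperty C}
    (h₀₁ : ∀ x y, P₀ x → P₁ y → ∀ f : x ⟶ y, f = 0) (h₀₂ : ∀ x y, P₀ x → P₂ y → ∀ f : x ⟶ y, f = 0)
    (h₁₂ : ∀ x y, P₁ x → P₂ y → ∀ f : x ⟶ y, f = 0) {x : C} {p₁ p₂ q₁ q₂ : Subobject x}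
    (hp : p₁ ≤ p₂) (hq : q₁ ≤ q₂) (hp₀ : P₀ (subquotient (bot_le : ⊥ ≤ p₁)))
    (hp₁ : P₁ (subquotient hp)) (hq₁ : P₁ (subquotient hq))
    (hq₂ : P₂ (subquotient (le_top : q₂ ≤ ⊤))) : p₁ ≤ q₁ ∧ p₂ ≤ q₂ := by
  -- The map `b → d / c` kills `a`, hence factors through `b / a` and vanishes by `H`; so `b` lies
  -- in `c`.
  have key {a b c d : Subobject x} (h : a ≤ b) (h' : c ≤ d) (hac : a ≤ c) (hbd : b ≤ d)
      (H : ∀ f : subquotient h ⟶ subquotient h', f = 0) : b ≤ c := by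
    let f : (b : C) ⟶ subquotient h' := Subobject.ofLE b d hbd ≫ subquotientπ h'
    have hf : Subobject.ofLE a b h ≫ f = 0 := by
      rw [← Category.assoc, Subobject.ofLE_comp_ofLE, comp_subquotientπ_eq_zero_iff,
        Subobject.ofLE_arrow]
      exact Subobject.factors_of_le _ hac (Subobject.factors_self a)
    have hf' : f = 0 := by
      rw [← (shortExact_subquotient h).exact.g_desc f hf,
        H ((shortExact_subquotient h).exact.desc f hf), comp_zero]
    rw [comp_subquotientπ_eq_zero_iff, Subobject.ofLE_arrow] at hf'
    exact Subobject.le_of_factors hf'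
  -- This crossed comparison comes first because both remaining ones need it.
  have h₁ : p₁ ≤ q₂ := key bot_le le_top bot_le le_top (h₀₂ _ _ hp₀ hq₂)
  exact ⟨key bot_le hq bot_le h₁ (h₀₁ _ _ hp₀ hq₁), key hp le_top h₁ le_top (h₁₂ _ _ hp₁ hq₂)⟩

end

/-- A fully faithful left exact functor embeds the poset of subobjects of `x` into that of `J.obj
x`. -/
lemma isNoetherianObject_of_map {C : Type u} [Category.{v} C] {C' : Type u'} [Category.{v} C'] (J : C ⥤ C')
    [J.Full] [J.Faithful] [PreservesFiniteLimits J] (x : C) (h : isNoetherianObject (J.obj x)) :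
    isNoetherianObject x := by
  have : WellFoundedGT (Subobject (J.obj x)) := h
  let φ : Subobject x → Subobject (J.obj x) := fun p => Subobject.mk (J.map p.arrow)
  have hφ {p q : Subobject x} : φ p ≤ φ q ↔ p ≤ q := by
    constructor
    · intro hpq
      refine Subobject.le_of_comm (J.preimage (Subobject.ofMkLEMk _ _ hpq)) ?_
      apply J.map_injective
      simp
    · intro hpq
      refine Subobject.mk_le_mk_of_comm (J.map (Subobject.ofLE p q hpq)) ?_
      rw [← J.map_comp, Subobject.ofLE_arrow]
  have hφ' : StrictMono φ := fun p q hpq => by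
    rw [lt_iff_le_not_ge] at hpq ⊢
    rwa [hφ, hφ]
  exact hφ'.wellFoundedGT

/-! ### Existence of the filtration. -/

section

variable {D : Type*} [Category* D] [Preadditive D] [HasZeroObject D] [HasShift D ℤ]
  [∀ n : ℤ, (shiftFunctor D n).Additive] [Pretriangulated D] (t : Triangulated.TStructure D)

/-- Such a `v` factors through `Z⟦-1⟧`, which lives in degrees `≥ m + 1`; so `n ≤ m` suffices. -/
lemma eq_zero_of_comp_mor₁_eq_zero {X Y Z : D} {f : X ⟶ Y} {g : Y ⟶ Z} {h : Z ⟶ X⟦(1 : ℤ)⟧}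
    (hT : Triangle.mk f g h ∈ distTriang D) {V : D} (v : V ⟶ X) (hv : v ≫ f = 0)
    (n m : ℤ) (hV : t.IsLE V n) (hZ : t.IsGE Z m) (hnm : n ≤ m := by lia) : v = 0 := by
  obtain ⟨l, hl⟩ := Triangle.coyoneda_exact₂ _ (inv_rot_of_distTriang _ hT) v hv
  have := t.isGE_shift Z m (-1) (m + 1)
  have hl' : l = 0 := t.zero_of_isLE_of_isGE l n (m + 1) (by lia) hV this
  rw [hl, hl']
  exact zero_comp

lemma exists_lift_mor₁ {X Y Z : D} {f : X ⟶ Y} {g : Y ⟶ Z} {h : Z ⟶ X⟦(1 : ℤ)⟧}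
    (hT : Triangle.mk f g h ∈ distTriang D) {V : D} (v : V ⟶ Y)
    (n m : ℤ) (hV : t.IsLE V n) (hZ : t.IsGE Z m) (hnm : n < m := by lia) :
    ∃ l : V ⟶ X, l ≫ f = v := by
  obtain ⟨l, hl⟩ := Triangle.coyoneda_exact₂ _ hT v (t.zero_of_isLE_of_isGE _ n m hnm hV hZ)
  exact ⟨l, hl.symm⟩

end

section

variable {C : Type u} [Category.{v} C] [Abelian C]

lemma pullback_cokernel_π_bot {x : C} (p : Subobject x) :
    (Subobject.pullback (cokernel.π p.arrow)).obj ⊥ = p :=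
  (pullback_bot_eq_mk (S := .mk p.arrow _ (cokernel.condition _))
    (ShortComplex.exact_cokernel _)).trans (Subobject.mk_arrow p)

/-- The third isomorphism theorem, for classes closed under extensions. -/
lemma prop_cokernel_comp (P : ObjectProperty C) [P.IsClosedUnderExtensions] {x y z : C}
    (f : x ⟶ y) (g : y ⟶ z) [Mono g] (hf : P (cokernel f)) (hg : P (cokernel g)) :
    P (cokernel (f ≫ g)) := by
  let S : ShortComplex C := .mk (cokernel.map f (f ≫ g) (𝟙 _) g (by simp))
    (cokernel.map (f ≫ g) g f (𝟙 _) (by simp)) (by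
      rw [← cancel_epi (cokernel.π f)]
      simp)
  have hker : S.Exact ∧ Mono S.f := by
    -- In the six-term sequence from `ker f` to `coker g`, index `3` is exactness at `coker (f ≫ g)`
    -- and index `2` is exactness at `coker f`; there `ker g = 0` yields the monomorphism.
    have hex := kernelCokernelCompSequence_exact f g
    refine ⟨hex.exact 3, (ShortComplex.exact_iff_mono _ ?_).1 (hex.exact 2)⟩
    exact IsZero.eq_of_src (isZero_kernel_of_mono g) _ _
  have := hker.2
  refine P.prop_X₂_of_shortExact (S := S) ?_ hf hg
  exact { exact := hker.1
          epi_g := epi_of_epi_fac (f := cokernel.π (f ≫ g)) (h := cokernel.π g) (by simp [S]) }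

end

section

variable {C : Type u} [Category.{v} C] [Abelian C]
  {D : Type u'} [Category.{w} D] [Preadditive D] [HasZeroObject D] [HasShift D ℤ]
  [∀ n : ℤ, (shiftFunctor D n).Additive] [Pretriangulated D]
  {tA tB : Triangulated.TStructure D} (htilt : IsTwoTilt tA tB)
  (ι : C ⥤ D) [ι.Full] [ι.Faithful] [ι.Additive] (hι : ι.essImage = tA.heart)

omit [Abelian C] [ι.Full] [ι.Faithful] [ι.Additive] in
include hι in
lemma isLE_of_essImage_eq_heart (x : C) : tA.IsLE (ι.obj x) 0 :=
  ((tA.mem_heart_iff _).1 (hι ▸ ι.obj_mem_essImage x)).1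

omit [Abelian C] [ι.Full] [ι.Faithful] [ι.Additive] in
include hι in
lemma isGE_of_essImage_eq_heart (x : C) : tA.IsGE (ι.obj x) 0 :=
  ((tA.mem_heart_iff _).1 (hι ▸ ι.obj_mem_essImage x)).2

omit [Abelian C] [ι.Full] [ι.Faithful] [ι.Additive] in
include hι in
lemma exists_iso_of_essImage_eq_heart (X : D) (h₁ : tA.IsLE X 0) (h₂ : tA.IsGE X 0) :
    ∃ x : C, Nonempty (ι.obj x ≅ X) := by
  have hX : tA.heart X := (tA.mem_heart_iff X).2 ⟨h₁, h₂⟩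
  rw [← hι] at hX
  exact hX

omit [ι.Faithful] in
include htilt hι in
/-- Every noetherian object `x` of the heart has a subobject `p` in `⟨Gen(A ∩ B)⟩` such that `x / p`
has no cohomology in degree `0` for the second t-structure. -/
lemma exists_subobject_gen (x : C) (hx : isNoetherianObject x) :
    ∃ p : Subobject x, extClosure (gen ((pure tB 0).inverseImage ι)) (p : C) ∧
      tB.IsGE (ι.obj (cokernel p.arrow)) 1 := by
  have : WellFoundedGT (Subobject x) := hx
  let E := extClosure (gen ((pure tB 0).inverseImage ι))
  obtain ⟨p, hp, hmax⟩ := WellFounded.has_min (wellFounded_gt (α := Subobject x))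
    {p | E (p : C)} ⟨⊥, extClosure_of_isZero _ _ (isZero_bot x)⟩
  refine ⟨p, hp, ?_⟩
  let y := cokernel p.arrow
  let π : x ⟶ y := cokernel.π p.arrow
  have hy := isGE_of_essImage_eq_heart ι hι y
  obtain ⟨b, r, f, g, h, hT, hb, hr⟩ := exists_truncation tB (ι.obj y) 0
  have hyB : tB.IsGE (ι.obj y) 0 := htilt.ge_zero _ hy
  have hb' : tB.IsGE b 0 := isGE₁ tB hT 0 1 hyB hr
  have hbA : tA.IsLE b 0 := htilt.isLE' b 0
  have hrA : tA.IsGE r (-1) := by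
    have : tB.IsGE r 1 := hr
    exact htilt.isGE' r 1 (-1)
  have hbA' : tA.IsGE b 0 := isGE₁ tA hT 0 (-1) hy hrA
  obtain ⟨b₀, ⟨e⟩⟩ := exists_iso_of_essImage_eq_heart ι hι b hbA hbA'
  let φ : b₀ ⟶ y := ι.preimage (e.hom ≫ f)
  -- The preimage `q` in `x` of the image of `φ` is an extension of an object of `Gen` by `p`, so
  -- maximality of `p` forces that image to vanish.
  have hφ : φ = 0 := by
    let q := (Subobject.pullback π).obj (imageSubobject φ)
    have hpq : p ≤ q := by
      conv_lhs => rw [← pullback_cokernel_π_bot p]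
      exact (Subobject.pullback π).monotone bot_le
    obtain ⟨e₁⟩ : Nonempty (subquotient hpq ≅ (imageSubobject φ : C)) := by
      obtain ⟨e₁⟩ := nonempty_subquotient_pullback_iso π (bot_le : ⊥ ≤ imageSubobject φ)
        ((Subobject.pullback π).monotone bot_le)
      let P : ObjectProperty C := fun z => Nonempty (z ≅ (imageSubobject φ : C))
      exact subquotient_prop_congr P hpq (pullback_cokernel_π_bot p).symm rfl _
        ⟨e₁ ≪≫ (subquotientBotIso _).symm⟩
    have hq : E (q : C) := by
      refine E.prop_X₂_of_shortExact (shortExact_subquotient hpq) hp (le_extClosure _ _ ?_)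
      refine ObjectProperty.prop_of_iso _ e₁.symm ⟨b₀, ?_, factorThruImageSubobject φ, inferInstance⟩
      exact (pure tB 0).prop_of_iso e.symm ((pure_iff ..).2 ⟨hb', hb⟩)
    have hqp : q ≤ p := by
      by_contra hqp
      exact hmax q hq (lt_of_le_not_ge hpq hqp)
    have h0 : subquotientπ hpq = 0 := by
      rw [← Category.id_comp (subquotientπ hpq), comp_subquotientπ_eq_zero_iff, Category.id_comp]
      exact Subobject.factors_of_le _ hqp (Subobject.factors_self q)
    have h1 : IsZero (imageSubobject φ : C) :=
      (IsZero.of_epi_eq_zero _ h0).of_iso e₁.symm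
    rw [← imageSubobject_arrow_comp φ, h1.eq_of_src (imageSubobject φ).arrow 0, comp_zero]
  have hf : f = 0 := by
    have h0 : ι.map φ = e.hom ≫ f := ι.map_preimage _
    rw [hφ, ι.map_zero] at h0
    rw [← cancel_epi e.hom, comp_zero, h0]
  -- Since `f = 0`, the identity of `b` factors through `r⟦-1⟧`, which lies in `tB`-degrees `≥ 2`.
  have hb0 : IsZero b := by
    rw [IsZero.iff_id_eq_zero]
    exact eq_zero_of_comp_mor₁_eq_zero tB hT (𝟙 b) (by rw [hf, comp_zero]) 0 1 hb hr
  exact tB.isGE₂ _ hT 1 (tB.isGE_of_isZero hb0 1) hr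

include htilt hι in
/-- Every object `x` of the heart without cohomology in degree `0` for the second t-structure
has a subobject concentrated in degree `1` with quotient in `⟨Sub(A ∩ Σ⁻² B)⟩`. -/
lemma exists_subobject_sub [IsTriangulated D] (ℓ : D → ℕ)
    (hℓ : ∀ (X Y Z : D) (f : X ⟶ Y) (g : Y ⟶ Z) (h : Z ⟶ X⟦(1 : ℤ)⟧),
      Triangle.mk f g h ∈ distTriang D → pure tB 1 X → pure tB 1 Y → pure tB 1 Z →
        ℓ Y = ℓ X + ℓ Z)
    (hℓ₀ : ∀ X, pure tB 1 X → ℓ X = 0 → IsZero X)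
    (n : ℕ) (x : C) {r w : D} {f : r ⟶ ι.obj x} {g : ι.obj x ⟶ w} {h : w ⟶ r⟦(1 : ℤ)⟧}
    (hT : Triangle.mk f g h ∈ distTriang D) (hr : pure tB 1 r) (hw : tB.IsGE w 2) (hn : ℓ r ≤ n) :
    ∃ (m : C) (j : m ⟶ x), Mono j ∧ pure tB 1 (ι.obj m) ∧
      extClosure (sub ((pure tB 2).inverseImage ι)) (cokernel j) := by
  induction n using Nat.strong_induction_on generalizing x r w with
  | _ n ih =>
  obtain ⟨hr₁, hr₂⟩ := (pure_iff ..).1 hr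
  have hxl := isLE_of_essImage_eq_heart ι hι x
  have hxg := isGE_of_essImage_eq_heart ι hι x
  -- These bounds place `w` in the heart of `tA` and `r` in `tA`-degrees `0` and `1`.
  have hw' : tB.IsLE w 2 := isLE₃ tB hT 2 1 hr₂ (htilt.le_zero _ hxl)
  have hrA : tA.IsLE r 1 := htilt.isLE' r 1
  have hwA : tA.IsGE w 0 := htilt.isGE' w 2 0
  have hwA' : tA.IsLE w 0 := isLE₃ tA hT 0 1 hrA hxl
  have hrA' : tA.IsGE r 0 := isGE₁ tA hT 0 0 hxg hwA
  obtain ⟨w₀, ⟨ew⟩⟩ := exists_iso_of_essImage_eq_heart ι hι w hwA' hwA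
  obtain ⟨m, s, a, b, c, hT', hml, hsg⟩ := exists_truncation tA r 0
  have hmg : tA.IsGE m 0 := isGE₁ tA hT' 0 1 hrA' hsg
  obtain ⟨m₀, ⟨em⟩⟩ := exists_iso_of_essImage_eq_heart ι hι m hml hmg
  have hsB : tB.IsGE s 1 := by
    have : tA.IsGE s 1 := hsg
    exact htilt.isGE s 1
  have hmB : tB.IsGE m 1 := isGE₁ tB hT' 1 1 hr₁ hsB
  let j : m₀ ⟶ x := ι.preimage (em.hom ≫ a ≫ f)
  let g₀ : x ⟶ w₀ := ι.preimage (g ≫ ew.inv)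
  have hj : ι.map j = em.hom ≫ a ≫ f := ι.map_preimage _
  have hg₀ : ι.map g₀ = g ≫ ew.inv := ι.map_preimage _
  have hfg : f ≫ g = 0 := comp_distTriang_mor_zero₁₂ _ hT
  have hjg : j ≫ g₀ = 0 := ι.map_injective (by
    rw [ι.map_comp, ι.map_zero, hj, hg₀]
    simp [reassoc_of% hfg])
  -- The fibres `w⟦-1⟧` of `f` and `s⟦-1⟧` of `a` lie in positive `tA`-degrees, so they receive no
  -- nonzero map from the heart.
  have hmono : Mono j := Preadditive.mono_of_cancel_zero _ fun {z} l hl => by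
    have hl' : (ι.map l ≫ em.hom ≫ a) ≫ f = 0 := by
      rw [Category.assoc, Category.assoc, ← hj, ← ι.map_comp, hl, ι.map_zero]
    have hzl := isLE_of_essImage_eq_heart ι hι z
    have h1 := eq_zero_of_comp_mor₁_eq_zero tA hT _ hl' 0 0 hzl hwA
    rw [← Category.assoc] at h1
    have h2 := eq_zero_of_comp_mor₁_eq_zero tA hT' _ h1 0 1 hzl hsg
    apply ι.map_injective
    rw [← cancel_mono em.hom, h2, ι.map_zero, zero_comp]
  have hex : (ShortComplex.mk j g₀ hjg).Exact := by
    refine ShortComplex.exact_of_f_is_kernel _ (KernelFork.IsLimit.ofι' _ _ fun {z} k hk => ?_)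
    have hzl := isLE_of_essImage_eq_heart ι hι z
    have hk' : ι.map k ≫ g = 0 := by
      rw [← cancel_mono ew.inv, Category.assoc, ← hg₀, ← ι.map_comp, zero_comp, hk, ι.map_zero]
    have h1 := Triangle.coyoneda_exact₂ _ hT (ι.map k) hk'
    have h2 := exists_lift_mor₁ tA hT' h1.choose 0 1 hzl hsg
    refine ⟨ι.preimage (h2.choose ≫ em.inv), ι.map_injective ?_⟩
    rw [ι.map_comp, ι.map_preimage]
    erw [hj]
    rw [Category.assoc, em.inv_hom_id_assoc, reassoc_of% h2.choose_spec]
    exact h1.choose_spec.symm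
  have hE : extClosure (sub ((pure tB 2).inverseImage ι)) (cokernel j) := by
    refine le_extClosure _ _ ⟨w₀, ?_, cokernel.desc j g₀ hjg, hex.mono_cokernelDesc⟩
    exact (pure tB 2).prop_of_iso ew.symm ((pure_iff ..).2 ⟨hw, hw'⟩)
  obtain ⟨m₁, m₂, a', b', c', hT₁, hm₁, hm₂⟩ := exists_truncation tB m 1
  have hm₂' : tB.IsGE m₂ 2 := hm₂
  have hm₁' : pure tB 1 m₁ := (pure_iff ..).2 ⟨isGE₁ tB hT₁ 1 2 hmB hm₂, hm₁⟩
  obtain ⟨z, u, v, hT₂⟩ := distinguished_cocone_triangle (a' ≫ a)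
  -- The octahedron provides a triangle `m₂ → z → s`, which bounds `z` below in `tB`-degree `1`.
  have o := Triangulated.someOctahedron rfl hT₁ hT' hT₂
  have hz : pure tB 1 z := (pure_iff ..).2
    ⟨tB.isGE₂ _ o.mem 1 (tB.isGE_of_ge m₂ 1 2) hsB, isLE₃ tB hT₂ 1 1 hm₁ hr₂⟩
  have hlen := hℓ _ _ _ _ _ _ hT₂ hm₁' hr hz
  -- If `z = 0`, then `a` is a split epimorphism, so `b = 0`; hence `s = 0` and `m ≅ r` already has
  -- `tB`-degree `1`. Otherwise `ℓ m₁ < ℓ r` and induction applies to `m₀`.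
  by_cases hz₀ : ℓ z = 0
  · have h1 : IsIso (a' ≫ a) := (Triangle.isZero₃_iff_isIso₁ _ hT₂).1 (hℓ₀ z hz hz₀)
    have hab : a ≫ b = 0 := comp_distTriang_mor_zero₁₂ _ hT'
    have hb : b = 0 := by
      rw [← cancel_epi (a' ≫ a), Category.assoc, hab, comp_zero, comp_zero]
    have hs : IsZero s := by
      rw [IsZero.iff_id_eq_zero]
      obtain ⟨l, hl⟩ := Triangle.yoneda_exact₃ _ hT' (𝟙 s) (by
        change b ≫ 𝟙 s = 0
        rw [hb, zero_comp])
      have h2 := tA.isLE_shift m 0 1 (-1)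
      rw [hl, tA.zero_of_isLE_of_isGE l (-1) 1 (by lia) h2 hsg]
      exact comp_zero
    have ha : IsIso a := (Triangle.isZero₃_iff_isIso₁ _ hT').1 hs
    exact ⟨m₀, j, hmono, (pure tB 1).prop_of_iso (em ≪≫ asIso a).symm hr, hE⟩
  · have hT₁' : Triangle.mk (a' ≫ em.inv) (em.hom ≫ b') c' ∈ distTriang D :=
      isomorphic_distinguished _ hT₁ _
        (Triangle.isoMk _ _ (Iso.refl _) em (Iso.refl _)
          (show (a' ≫ em.inv) ≫ em.hom = 𝟙 _ ≫ a' by simp)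
          (show (em.hom ≫ b') ≫ 𝟙 _ = em.hom ≫ b' by simp)
          (show c' ≫ (𝟙 _)⟦(1 : ℤ)⟧' = 𝟙 _ ≫ c' by simp))
    obtain ⟨m', j', hj', hm', hE'⟩ := ih (ℓ m₁) (by lia) m₀ hT₁' hm₁' hm₂ le_rfl
    exact ⟨m', j' ≫ j, mono_comp _ _, hm', prop_cokernel_comp _ j' j hE' hE⟩

include htilt hι in
/-- The filtration of a noetherian object of the heart. -/
lemma exists_filtration [IsTriangulated D] (ℓ : D → ℕ)
    (hℓ : ∀ (X Y Z : D) (f : X ⟶ Y) (g : Y ⟶ Z) (h : Z ⟶ X⟦(1 : ℤ)⟧),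
      Triangle.mk f g h ∈ distTriang D → pure tB 1 X → pure tB 1 Y → pure tB 1 Z →
        ℓ Y = ℓ X + ℓ Z)
    (hℓ₀ : ∀ X, pure tB 1 X → ℓ X = 0 → IsZero X) (x : C) (hx : isNoetherianObject x) :
    ∃ (p q : Subobject x) (h : p ≤ q),
      extClosure (gen ((pure tB 0).inverseImage ι)) (subquotient (bot_le : ⊥ ≤ p)) ∧
      (pure tB 1).inverseImage ι (subquotient h) ∧
      extClosure (sub ((pure tB 2).inverseImage ι)) (subquotient (le_top : q ≤ ⊤)) := by
  obtain ⟨p, hp, hy⟩ := exists_subobject_gen htilt ι hι x hx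
  let π : x ⟶ cokernel p.arrow := cokernel.π p.arrow
  obtain ⟨r, w, f, g, h, hT, hr, hw⟩ := exists_truncation tB (ι.obj (cokernel p.arrow)) 1
  obtain ⟨m, j, hj, hm, hE⟩ := exists_subobject_sub htilt ι hι ℓ hℓ hℓ₀ (ℓ r) _ hT
    ((pure_iff ..).2 ⟨isGE₁ tB hT 1 2 hy hw, hr⟩) hw le_rfl
  let m' := Subobject.mk j
  let q := (Subobject.pullback π).obj m'
  have hpq : p ≤ q := by
    conv_lhs => rw [← pullback_cokernel_π_bot p]
    exact (Subobject.pullback π).monotone bot_le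
  refine ⟨p, q, hpq, ObjectProperty.prop_of_iso _ (subquotientBotIso p) hp, ?_, ?_⟩
  · obtain ⟨e⟩ := nonempty_subquotient_pullback_iso π (bot_le : ⊥ ≤ m')
      ((Subobject.pullback π).monotone bot_le)
    refine subquotient_prop_congr _ hpq (pullback_cokernel_π_bot p).symm rfl
      ((Subobject.pullback π).monotone bot_le) ?_
    exact ObjectProperty.prop_of_iso _
      ((Subobject.underlyingIso j).symm ≪≫ subquotientBotIso m' ≪≫ e.symm) hm
  · obtain ⟨e⟩ := nonempty_subquotient_pullback_iso π (le_top : m' ≤ ⊤)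
      ((Subobject.pullback π).monotone le_top)
    refine subquotient_prop_congr _ le_top rfl (Subobject.pullback_top π).symm
      ((Subobject.pullback π).monotone le_top) ?_
    obtain ⟨e'⟩ := nonempty_subquotient_top_iso m'
    let e'' : cokernel m'.arrow ≅ cokernel j :=
      cokernel.mapIso _ _ (Subobject.underlyingIso j) (Iso.refl _) (by simp [m'])
    exact ObjectProperty.prop_of_iso _ (e ≪≫ e' ≪≫ e'').symm hE

end

/-! ### Finite length of modules over `(End T)ᵒᵖ`. -/

section

variable (k : Type w') [Field k] {C : Type u} [Category.{v} C] [Abelian C] [Linear k C]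
  [∀ X Y : C, Module.Finite k (X ⟶ Y)] (T : C)

include k in
lemma isArtinianRing_endOp : IsArtinianRing (End T)ᵐᵒᵖ := by
  have h : Module.Finite k (End T) := inferInstanceAs (Module.Finite k (T ⟶ T))
  have h' : Module.Finite k (End T)ᵐᵒᵖ := Module.Finite.equiv (MulOpposite.opLinearEquiv k)
  exact isArtinian_of_tower k inferInstance

variable {T}

/-- The length of a finitely generated module over `(End T)ᵒᵖ`. -/
def modLength (M : ModEndOp k T) : ℕ :=
  (Module.length (End T)ᵐᵒᵖ ((ModEndOp.ι k T).obj M)).toNat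

lemma length_ne_top (M : ModEndOp k T) :
    Module.length (End T)ᵐᵒᵖ ((ModEndOp.ι k T).obj M) ≠ ⊤ := by
  have := isArtinianRing_endOp k T
  have := isNoetherianRing_endOp k T
  have : Module.Finite (End T)ᵐᵒᵖ ((ModEndOp.ι k T).obj M) := M.property
  exact Module.length_ne_top

lemma modLength_of_shortExact {S : ShortComplex (ModEndOp k T)} (hS : S.ShortExact) :
    modLength k S.X₂ = modLength k S.X₁ + modLength k S.X₃ := by
  have := hS.mono_f
  have := hS.epi_g
  have hS' := hS.map (ModEndOp.ι k T)
  have h := Module.length_eq_add_of_exact _ _ hS'.moduleCat_injective_f hS'.moduleCat_surjective_g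
    ((ShortComplex.ShortExact.moduleCat_exact_iff_function_exact _).1 hS'.exact)
  have h' : Module.length (End T)ᵐᵒᵖ ((ModEndOp.ι k T).obj S.X₂) =
    Module.length (End T)ᵐᵒᵖ ((ModEndOp.ι k T).obj S.X₁) +
      Module.length (End T)ᵐᵒᵖ ((ModEndOp.ι k T).obj S.X₃) := h
  rw [modLength, h', ENat.toNat_add (length_ne_top k _) (length_ne_top k _), modLength, modLength]

lemma isZero_of_modLength_eq_zero (M : ModEndOp k T) (hM : modLength k M = 0) : IsZero M := by
  rw [modLength, ENat.toNat_eq_zero, or_iff_left (length_ne_top k M),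
    Module.length_eq_zero_iff] at hM
  rw [IsZero.iff_id_eq_zero]
  apply (ModEndOp.ι k T).map_injective
  exact (ModuleCat.isZero_of_subsingleton _).eq_of_src _ _

end

/-! ### Cohomology of objects of `D^b` concentrated in one degree. -/

section

variable {C : Type u} [Category.{v} C] [Abelian C] [HasDerivedCategory.{w} C]

lemma pure_t_iff (X : Db C) (n : ℤ) :
    pure (Db.t C) n X ↔ ∀ i, i ≠ n → IsZero ((Db.homology C i).obj X) := by
  rw [pure_iff, Db.isGE_iff, Db.isLE_iff]
  exact ⟨fun h i hi => (lt_or_gt_of_ne hi).elim (h.1 i) (h.2 i),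
    fun h => ⟨fun i hi => h i hi.ne, fun i hi => h i hi.ne'⟩⟩

lemma isZero_of_pure (X : Db C) (n : ℤ) (hX : pure (Db.t C) n X)
    (h : IsZero ((Db.homology C n).obj X)) : IsZero X := by
  rw [pure_t_iff] at hX
  have h' : ∀ i, IsZero ((Db.homology C i).obj X) := fun i => by
    by_cases hi : i = n
    · exact hi ▸ h
    · exact hX i hi
  have := (Db.isGE_iff X 1).2 fun i _ => h' i
  have := (Db.isLE_iff X 0).2 fun i _ => h' i
  exact (Db.t C).isZero X 0 1

/-- In the long exact sequence the neighbours `H^{n-1}(Z)` and `H^{n+1}(X)` vanish. This makes the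
length of `H¹F` additive on triangles. -/
lemma shortExact_homology {X Y Z : Db C} {f : X ⟶ Y} {g : Y ⟶ Z} {h : Z ⟶ X⟦(1 : ℤ)⟧}
    (hT : Triangle.mk f g h ∈ distTriang (Db C)) (n : ℤ) (hX : pure (Db.t C) n X)
    (hZ : pure (Db.t C) n Z) :
    (ShortComplex.mk ((Db.homology C n).map f) ((Db.homology C n).map g) (by
      rw [← Functor.map_comp, show f ≫ g = 0 from comp_distTriang_mor_zero₁₂ _ hT]
      exact (DerivedCategory.homologyFunctor C n).map_zero _ _)).ShortExact := by
  rw [pure_t_iff] at hX hZ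
  have hT' := (Db.ι C).map_distinguished _ hT
  exact {
    exact := DerivedCategory.HomologySequence.exact₂ _ hT' n
    mono_f := (DerivedCategory.HomologySequence.mono_homologyMap_mor₁_iff _ hT' (n - 1) n).2
      ((hZ (n - 1) (by lia)).eq_of_src _ _)
    epi_g := (DerivedCategory.HomologySequence.epi_homologyMap_mor₂_iff _ hT' n (n + 1)).2
      ((hX (n + 1) (by lia)).eq_of_tgt _ _) }

end

/-! ### The two inclusions between the hearts. -/

section

variable {D : Type*} [Category* D] [Preadditive D] [HasZeroObject D] [HasShift D ℤ]
  [∀ n : ℤ, (shiftFunctor D n).Additive] [Pretriangulated D]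

lemma pure_of_distinguished (t : Triangulated.TStructure D) (n : ℤ) {X Y Z : D} {f : X ⟶ Y}
    {g : Y ⟶ Z} {h : Z ⟶ X⟦(1 : ℤ)⟧} (hT : Triangle.mk f g h ∈ distTriang D)
    (hX : pure t n X) (hZ : pure t n Z) : pure t n Y := by
  rw [pure_iff] at hX hZ ⊢
  exact ⟨t.isGE₂ _ hT n hX.1 hZ.1, t.isLE₂ _ hT n hX.2 hZ.2⟩

/-- By dévissage it suffices to treat one `tA`-degree `i ≤ 0`; shifting it to degree `0` gives the
bound `2 + i ≤ 2`. -/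
lemma le_of_pure_zero_le {tA tB : Triangulated.TStructure D}
    (h : ∀ X, pure tA 0 X → tB.IsLE X 2) (X : D) (a : ℤ) (h₁ : tA.IsGE X a) (h₂ : tA.IsLE X 0) :
    tB.IsLE X 2 := by
  have : (tB.le 2).IsTriangulatedClosed₂ := .mk' fun T hT hX hZ =>
    (tB.isLE₂ T hT 2 ⟨hX⟩ ⟨hZ⟩).le
  obtain ⟨n, hn⟩ : ∃ n : ℕ, -(n : ℤ) ≤ a := ⟨(-a).toNat, by lia⟩
  refine ⟨devissage tA (tB.le 2) (-n) n ?_ X (tA.isGE_of_ge X (-n) a hn) (by simpa using h₂)⟩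
  intro i _ hi Y hY
  obtain ⟨h₃, h₄⟩ := (pure_iff ..).1 hY
  have := h (Y⟦i⟧) ((pure_iff ..).2 ⟨tA.isGE_shift Y i i 0, tA.isLE_shift Y i i 0⟩)
  have := tB.isLE_of_shift Y (2 + i) i 2
  exact (tB.isLE_of_le Y (2 + i) 2).le

lemma heart_eq_pure (t : Triangulated.TStructure D) : t.heart = pure t 0 := by
  ext X
  rw [t.mem_heart_iff, pure_iff, and_comm]

namespace IsTwoTilt

variable {tA tB : Triangulated.TStructure D}

lemma heart_le (h : IsTwoTilt tA tB) :
    tA.heart ≤ (tB.heart.extensionProduct (sigma (-1) tB.heart)).extensionProduct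
      (sigma (-2) tB.heart) := by
  intro X hX
  obtain ⟨_, _⟩ := (tA.mem_heart_iff X).1 hX
  have := h.isGE X 0
  have := h.isLE X 0 (0 + 2)
  rw [sigma_heart tB (-1) (0 + 1) (by lia), sigma_heart tB (-2) (0 + 2) (by lia), heart_eq_pure]
  exact extensionProduct_pure tB X 0

lemma heart_le' (h : IsTwoTilt tA tB) :
    tB.heart ≤ ((sigma 2 tA.heart).extensionProduct (sigma 1 tA.heart)).extensionProduct
      tA.heart := by
  intro X hX
  obtain ⟨_, _⟩ := (tB.mem_heart_iff X).1 hX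
  have := h.isGE' X 0 (-2)
  have : tA.IsLE X (-2 + 2) := h.isLE' X 0
  rw [sigma_heart tA 2 (-2) (by lia), sigma_heart tA 1 (-2 + 1) (by lia), heart_eq_pure]
  exact extensionProduct_pure tA X (-2)

end IsTwoTilt

end

/-! ### Extension closure and Hom-vanishing for the filtration classes. -/

section

variable {C : Type u} [Category.{v} C] [Abelian C] [HasDerivedCategory.{w} C]

lemma Db.exists_distinguished {S : ShortComplex C} (hS : S.ShortExact) :
    ∃ h : (Db.single C).obj S.X₃ ⟶ ((Db.single C).obj S.X₁)⟦(1 : ℤ)⟧,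
      Triangle.mk ((Db.single C).map S.f) ((Db.single C).map S.g) h ∈ distTriang (Db C) := by
  let δ : (Db.ι C).obj ((Db.single C).obj S.X₃) ⟶
    ((Db.ι C).obj ((Db.single C).obj S.X₁))⟦(1 : ℤ)⟧ := hS.singleδ
  refine ⟨(Db.ι C).preimage (δ ≫ ((Db.ι C).commShiftIso (1 : ℤ)).inv.app _), ?_⟩
  rw [← (Db.ι C).map_distinguished_iff]
  refine isomorphic_distinguished _ hS.singleTriangle_distinguished _
    (Triangle.isoMk _ _ (Iso.refl _) (Iso.refl _) (Iso.refl _) ?_ ?_ ?_)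
  · exact (Category.comp_id _).trans (Category.id_comp _).symm
  · exact (Category.comp_id _).trans (Category.id_comp _).symm
  · change ((Db.ι C).map ((Db.ι C).preimage _) ≫ ((Db.ι C).commShiftIso (1 : ℤ)).hom.app _) ≫
      (𝟙 _)⟦1⟧' = 𝟙 _ ≫ δ
    rw [Functor.map_preimage, Category.assoc, Category.assoc, Iso.inv_hom_id_app_assoc,
      CategoryTheory.Functor.map_id, Category.id_comp]
    exact Category.comp_id _

variable (t : Triangulated.TStructure (Db C))

instance (n : ℤ) : ((pure t n).inverseImage (Db.single C)).IsClosedUnderExtensions where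
  prop_X₂_of_shortExact hS h₁ h₃ := by
    obtain ⟨h, hT⟩ := Db.exists_distinguished hS
    exact pure_of_distinguished t n hT h₁ h₃

lemma eq_zero_of_pure {i j : ℤ} (hij : i < j) {x y : C} (hx : (pure t i).inverseImage (Db.single C) x)
    (hy : (pure t j).inverseImage (Db.single C) y) (f : x ⟶ y) : f = 0 := by
  obtain ⟨-, _⟩ := (pure_iff ..).1 hx
  obtain ⟨_, -⟩ := (pure_iff ..).1 hy
  exact (Db.single C).map_injective (by rw [t.zero ((Db.single C).map f) i j hij, Functor.map_zero])

/-- The classes of the filtration, for an arbitrary t-structure on `D^b(C)`. -/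
def tClass : Fin 3 → ObjectProperty C :=
  ![extClosure (gen ((pure t 0).inverseImage (Db.single C))), (pure t 1).inverseImage (Db.single C),
    extClosure (sub ((pure t 2).inverseImage (Db.single C)))]

lemma isClosedUnderExtensions_tClass (i : Fin 3) : (tClass t i).IsClosedUnderExtensions := by
  fin_cases i
  · exact extClosure_isClosedUnderExtensions (gen ((pure t 0).inverseImage (Db.single C)))
  · exact inferInstanceAs ((pure t 1).inverseImage (Db.single C)).IsClosedUnderExtensions
  · exact extClosure_isClosedUnderExtensions (sub ((pure t 2).inverseImage (Db.single C)))

lemma tClass_hom_eq_zero (i j : Fin 3) (hij : i < j) (x y : C) (hx : tClass t i x)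
    (hy : tClass t j y) (f : x ⟶ y) : f = 0 := by
  have h₀₁ {x y : C} (hx : tClass t 0 x) (hy : tClass t 1 y) (f : x ⟶ y) : f = 0 :=
    homLeft_extClosure_gen (fun _ hz => eq_zero_of_pure t (by lia) hz hy) _ hx f
  have h₁₂ {x y : C} (hx : tClass t 1 x) (hy : tClass t 2 y) (f : x ⟶ y) : f = 0 :=
    homRight_extClosure_sub (fun _ hz => eq_zero_of_pure t (by lia) hx hz) _ hy f
  have h₀₂ {x y : C} (hx : tClass t 0 x) (hy : tClass t 2 y) (f : x ⟶ y) : f = 0 :=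
    homLeft_extClosure_gen (fun _ hz =>
      homRight_extClosure_sub (fun _ hz' => eq_zero_of_pure t (by lia) hz hz') _ hy) _ hx f
  fin_cases i <;> fin_cases j
  all_goals first
    | exact absurd hij (by decide)
    | exact h₀₁ hx hy f
    | exact h₀₂ hx hy f
    | exact h₁₂ hx hy f

end

/-! ### Application to the t-structure pulled back along `F`. -/

section

variable {C : Type u} [Category.{v} C] [Abelian C] [HasDerivedCategory.{w} C]
  {D : Type u'} [Category.{v} D] [Abelian D] [HasDerivedCategory.{w'} D]
  (F : Db C ⥤ Db D) [F.CommShift ℤ] [F.IsTriangulated] [F.IsEquivalence]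

lemma pullback_isGE_iff (t : Triangulated.TStructure (Db D)) (X : Db C) (n : ℤ) :
    (tStructurePullback F t).IsGE X n ↔ t.IsGE (F.obj X) n :=
  ⟨fun h => ⟨h.ge⟩, fun h => ⟨h.ge⟩⟩

lemma pullback_isLE_iff (t : Triangulated.TStructure (Db D)) (X : Db C) (n : ℤ) :
    (tStructurePullback F t).IsLE X n ↔ t.IsLE (F.obj X) n :=
  ⟨fun h => ⟨h.le⟩, fun h => ⟨h.le⟩⟩

lemma pullback_pure (t : Triangulated.TStructure (Db D)) (n : ℤ) :
    pure (tStructurePullback F t) n = (pure t n).inverseImage F := rfl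

lemma pullbackHeart_eq : pullbackHeart F = (tStructurePullback F (Db.t D)).heart := by
  rw [pullbackHeart, Db.heart_eq, heart_eq_pure, heart_eq_pure, pullback_pure]

lemma concentrated_eq (i : ℤ) : concentrated F i =
    (pure (tStructurePullback F (Db.t D)) i).inverseImage (Db.single C) := by
  ext x
  exact (pure_t_iff (F.obj ((Db.single C).obj x)) i).symm

lemma filtClass_eq : filtClass F = tClass (tStructurePullback F (Db.t D)) := by
  simp only [filtClass, tClass, concentrated_eq]

end

section

variable {k : Type w} [Field k]
  {C : Type u} [Category.{v} C] [Abelian C] [HasDerivedCategory.{w₁} C]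
  {A : Type u'} [Category.{v} A] [Abelian A] [Linear k A] [∀ X Y : A, Module.Finite k (X ⟶ Y)]
  {T : A} [HasDerivedCategory.{w₃} (ModEndOp k T)]
  (F : Db C ⥤ Db (ModEndOp k T)) [F.CommShift ℤ] [F.IsTriangulated] [F.IsEquivalence]

lemma exists_tClass_filtration
    (htilt : IsTwoTilt (Db.t C) (tStructurePullback F (Db.t (ModEndOp k T)))) (x : C)
    (hx : isNoetherianObject x) :
    ∃ (p q : Subobject x) (h : p ≤ q),
      tClass (tStructurePullback F (Db.t (ModEndOp k T))) 0 (subquotient (bot_le : ⊥ ≤ p)) ∧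
      tClass (tStructurePullback F (Db.t (ModEndOp k T))) 1 (subquotient h) ∧
      tClass (tStructurePullback F (Db.t (ModEndOp k T))) 2 (subquotient (le_top : q ≤ ⊤)) := by
  refine exists_filtration htilt (Db.single C) Db.heart_eq
    -- The function `ℓ` is the length of `H¹F`, finite because `End T` is finite-dimensional.
    (fun X => modLength k ((Db.homology _ 1).obj (F.obj X))) ?_ ?_ x hx
  · intro X Y Z f g h hT hX _ hZ
    exact modLength_of_shortExact k (shortExact_homology (F.map_distinguished _ hT) 1 hX hZ)
  · intro X hX h
    have := isZero_of_pure (F.obj X) 1 hX (isZero_of_modLength_eq_zero k _ h)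
    exact (IsZero.iff_id_eq_zero X).2 (F.map_injective (this.eq_of_src _ _))

lemma existsUnique_tClass_filtration
    (htilt : IsTwoTilt (Db.t C) (tStructurePullback F (Db.t (ModEndOp k T)))) (x : C)
    (hx : isNoetherianObject x) :
    ∃! p : Subobject x × Subobject x, ∃ h : p.1 ≤ p.2,
      tClass (tStructurePullback F (Db.t (ModEndOp k T))) 0 (subquotient (bot_le : ⊥ ≤ p.1)) ∧
      tClass (tStructurePullback F (Db.t (ModEndOp k T))) 1 (subquotient h) ∧
      tClass (tStructurePullback F (Db.t (ModEndOp k T))) 2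
        (subquotient (le_top : p.2 ≤ ⊤)) := by
  have hom := tClass_hom_eq_zero (tStructurePullback F (Db.t (ModEndOp k T)))
  obtain ⟨p, q, h, hp⟩ := exists_tClass_filtration F htilt x hx
  refine ⟨⟨p, q⟩, ⟨h, hp⟩, ?_⟩
  rintro ⟨p', q'⟩ ⟨h', hp'⟩
  have h₁ := filtration_le_of_orthogonal (hom 0 1 (by decide)) (hom 0 2 (by decide))
    (hom 1 2 (by decide)) h h' hp.1 hp.2.1 hp'.2.1 hp'.2.2
  have h₂ := filtration_le_of_orthogonal (hom 0 1 (by decide)) (hom 0 2 (by decide))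
    (hom 1 2 (by decide)) h' h hp'.1 hp'.2.1 hp.2.1 hp.2.2
  exact Prod.ext (le_antisymm h₂.1 h₁.1) (le_antisymm h₂.2 h₁.2)

end

end JMS

end

theorem mainTheorem5
    (k : Type w) [Field k]
    (𝒜 : Type u) [Category.{v} 𝒜] [Abelian 𝒜] [Linear k 𝒜] [∀ X Y : 𝒜, Module.Finite k (X ⟶ Y)]
    (𝒜' : Type u') [Category.{v} 𝒜'] [Abelian 𝒜'] [IsGrothendieckAbelian.{v} 𝒜']
    (hgen : (isNoetherianObject (C := 𝒜')).IsSeparating)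
    (J : 𝒜 ⥤ 𝒜') [J.Full] [J.Faithful] [J.Additive]
    [PreservesFiniteLimits J] [PreservesFiniteColimits J]
    (hJ : J.essImage = isNoetherianObject)
    (T : 𝒜)
    [HasDerivedCategory.{w₁} 𝒜] [HasDerivedCategory.{w₂} 𝒜']
    [HasDerivedCategory.{w₃} (ModEndOp k T)]
    [HasDerivedCategory.{w₄} (ModuleCat.{v} (End T)ᵐᵒᵖ)]
    (F : Db 𝒜 ⥤ Db (ModEndOp k T))
    [F.CommShift ℤ] [F.IsTriangulated] [F.IsEquivalence]
    (hF : Nonempty (F ⋙ dbToPlus (ModEndOp.ι k T) ≅ dbToPlus J ⋙ rHom J T))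
    (hpd : ∀ (X : 𝒜) (i : ℤ), 3 ≤ i →
      IsZero ((Db.homology (ModEndOp k T) i).obj (F.obj ((Db.single 𝒜).obj X)))) :
    let A : ObjectProperty (Db 𝒜) := Db.heart 𝒜
    let B : ObjectProperty (Db 𝒜) := pullbackHeart F
    let E : Fin 3 → ObjectProperty 𝒜 := filtClass F
    A ≤ (B.extensionProduct (sigma (-1) B)).extensionProduct (sigma (-2) B) ∧
    B ≤ ((sigma 2 A).extensionProduct (sigma 1 A)).extensionProduct A ∧
    (∀ i : ℤ, concentrated F i = (sigma (-i) B).inverseImage (Db.single 𝒜)) ∧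
    (∀ i : Fin 3, (E i).IsClosedUnderExtensions) ∧
    (∀ i j : Fin 3, i < j → ∀ x y : 𝒜, E i x → E j y → ∀ f : x ⟶ y, f = 0) ∧
    (∀ x : 𝒜, ∃! p : Subobject x × Subobject x, ∃ h : p.1 ≤ p.2,
      E 0 (subquotient (bot_le : ⊥ ≤ p.1)) ∧
      E 1 (subquotient h) ∧
      E 2 (subquotient (le_top : p.2 ≤ ⊤))) := by
  intro A B E
  obtain ⟨e⟩ := hF
  let tB := tStructurePullback F (Db.t (ModEndOp k T))
  have htilt : IsTwoTilt (Db.t 𝒜) tB := by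
    refine ⟨fun X hX => (pullback_isGE_iff F _ X 0).2 (isGE_obj_of_iso_rHom k J T F e X 0 hX),
      fun X hX => ?_⟩
    -- Boundedness below reduces the upper bound to objects of the heart, where it is `hpd`.
    obtain ⟨a, ha⟩ := X.property.1
    have ha' : (Db.t 𝒜).IsGE X a := by
      rw [ObjectProperty.tStructure_isGE_iff]
      exact ha
    refine le_of_pure_zero_le (fun Y hY => ?_) X a ha' hX
    rw [← heart_eq_pure, ← Db.heart_eq] at hY
    obtain ⟨y, ⟨e'⟩⟩ := hY
    rw [pullback_isLE_iff, ← isLE_iff_of_iso _ (F.mapIso e'), Db.isLE_iff]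
    exact fun i hi => hpd y i hi
  have hA : A = (Db.t 𝒜).heart := Db.heart_eq
  have hB : B = tB.heart := pullbackHeart_eq F
  have hE : E = tClass tB := filtClass_eq F
  rw [hA, hB, hE]
  refine ⟨htilt.heart_le, htilt.heart_le', fun i => ?_, isClosedUnderExtensions_tClass tB,
    tClass_hom_eq_zero tB, fun x => ?_⟩
  · rw [concentrated_eq, sigma_heart tB (-i) i (by lia)]
  · exact existsUnique_tClass_filtration F htilt x
      (isNoetherianObject_of_map J x (hJ ▸ J.obj_mem_essImage x))
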